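/- Let $k \ge 5$ be an odd integer, and let $G$ be a finite simple planar graph of girth at least $k$ that contains no cycle whose length lies in $\{k+1, k+2, \ldots, \lfloor 22k/3 \rfloor\}$ (in particular, $G$ may be any such graph of girth exactly $k$; a forest counts as having infinite girth). Then $G$ has a fractional $\left(k : \frac{k-1}{2}\right)$-coloring, that is, there is a map $\varphi$ assigning to each vertex of $G$ a subset of $\{1,\ldots,k\}$ with exactly $\frac{k-1}{2}$ elements such that $\varphi(u) \cap \varphi(v) = \emptyset$ whenever $uv$ is an edge of $G$. -/

import Mathlib

namespace SimpleGraph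

variable {V : Type*}

/-- A rotation system (combinatorial embedding) of a locally finite graph: for every vertex, a
cyclic ordering of the darts (oriented edges) leaving that vertex. The orderings are packed into
one permutation `next` of the darts, whose cycles are exactly the sets of darts with a common
initial vertex. -/
structure RotationSystem (G : SimpleGraph V) where
  /-- The successor of a dart in the cyclic order around its initial vertex. -/
  next : Equiv.Perm G.Dart
  /-- The successor of a dart leaves from the same vertex. -/
  next_fst : ∀ d : G.Dart, (next d).fst = d.fst
  /-- The darts leaving a vertex form a single cycle of the permutation. -/
  sameCycle : ∀ d e : G.Dart, d.fst = e.fst → next.SameCycle d e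

namespace RotationSystem

variable {G : SimpleGraph V} (R : G.RotationSystem)

/-- Face tracing: traverse a dart `u → v`, and leave `v` by the dart that follows `v → u` in the
cyclic order around `v`. -/
def facePerm : Equiv.Perm G.Dart :=
  (Function.Involutive.toPerm Dart.symm Dart.symm_involutive).trans R.next

/-- The faces that have an edge on their boundary: the orbits of face tracing. -/
def FaceOrbit : Type _ :=
  Quotient (Equiv.Perm.SameCycle.setoid R.facePerm)

/-- The faces of the embedding, where each connected component is embedded on a surface of its
own: the orbits of face tracing, and one face for every isolated vertex (a component that
consists of a single vertex lies on a sphere, and the rest of this sphere is its only face). -/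
def Face : Type _ :=
  R.FaceOrbit ⊕ {v : V // ∀ w, ¬ G.Adj v w}

/-- The embedding has genus zero: by the Euler-Poincaré formula, the closed orientable surfaces
that carry the connected components have total Euler characteristic `|V| - |E| + |F|`. Each of
them has Euler characteristic at most `2`, with equality only for the sphere, so all of them are
spheres iff the total is twice the number of components. -/
def IsSpherical : Prop :=
  (Nat.card V : ℤ) - Nat.card G.edgeSet + Nat.card R.Face = 2 * Nat.card G.ConnectedComponent

end RotationSystem

/-- A finite graph is planar if it has a combinatorial embedding of genus zero, that is, one in
which every connected component is embedded in the sphere. -/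
def IsPlanar [Finite V] (G : SimpleGraph V) : Prop :=
  ∃ R : G.RotationSystem, R.IsSpherical

/-- A fractional `(a : b)`-colouring: a set of `b` out of `a` colours is assigned to every vertex,
and adjacent vertices receive disjoint sets. -/
structure FractionalColoring (G : SimpleGraph V) (a b : ℕ) where
  /-- The set of colours of a vertex. -/
  color : V → Finset (Fin a)
  card_color : ∀ v, (color v).card = b
  disjoint : ∀ u v, G.Adj u v → Disjoint (color u) (color v)

end SimpleGraph

/-! Write k = 2t+1. The colouring is a homomorphism to the graph of t-subsets of a k-set in which
disjoint sets are adjacent. Two t-sets with m common elements have the even distance 2(t-m), the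
Hamming distance of the sets, and the odd distance 2m+1, the Hamming distance of one set to the
complement of the other; these add up to k. A path of ℓ edges can be coloured between prescribed end
sets iff their distance of the parity of ℓ is at most ℓ. Paths can therefore be contracted to
weighted links. Links also carry a number μ: some piece of length μ must have its ends at distance
exactly μ, so by the triangle inequality the whole link spans at least 2μ-ℓ. This is `LinkRel`, and
`LinkRel.exists_between` shows that it is stable under composition in series.

The stronger statement `LinkGraph.Admissible.colorable` treats planar weighted multigraphs whose
cycles have length k or more than 22k/3, by induction on the number of links. Links of length at
least 2t and vertices of degree one are removed, and vertices of degree two are suppressed. Two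
parallel links must form a cycle of length k; the longer one is deleted and the shorter one made
rigid, which forces the right distance for the deleted link. The last reducible configuration is a
triangle of length k whose corners have degree three and whose three exits have length at least t+6
(`LinkRel.exists_triangle`): the colours are ordered so that every set of a suitable closed k-walk
meets each of the three prescribed outer sets in about half of its elements.

If nothing reduces, discharging gives a contradiction. Distinct cycles of length k share no edge,
because their sum would have even length below 2k. Counting lengths over a family of facial cycles,
together with Euler's inequality, leaves too little charge at the vertices to give 25k to each short
cycle; but each one receives that much unless it is the reducible triangle.

Planarity enters only through MacLane's criterion, which makes deletion and suppression linear
algebra over the field with two elements. For a genus-zero rotation system the criterion follows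
from a dimension count (`RotationSystem.IsSpherical.isFlat`). -/

/-! ### Distances between t-subsets and composition of links. -/

/-- The constraint that a link of length `ℓ` puts on the number `m` of common colours of its ends,
if the longest rigid step of the link is `μ`: the distance of the ends in the middle layers of the
cube, measured with the parity of `ℓ`, is at most `ℓ` and at least `2 μ - ℓ`. -/
def LinkRel (t ℓ μ m : ℕ) : Prop :=
  (ℓ % 2 = 0 ∧ 2 * t ≤ ℓ + 2 * m ∧ 2 * μ + 2 * m ≤ 2 * t + ℓ) ∨
  (ℓ % 2 = 1 ∧ 2 * m + 1 ≤ ℓ ∧ 2 * μ ≤ 2 * m + 1 + ℓ)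

/-- The lower bound 2μ-ℓ is not positive, and the distance of the parity of ℓ never exceeds ℓ, so
such a link imposes nothing. -/
theorem linkRel_of_two_mul_le {t ℓ μ m : ℕ} (hℓ : 2 * t ≤ ℓ) (hμ : μ ≤ t) (hm : m ≤ t) :
    LinkRel t ℓ μ m := by
  unfold LinkRel; omega

/-- The hypotheses are the three triangle inequalities and the perimeter bound for even distances.
They leave room for the size i of X ∩ Y ∩ W, after which W is assembled from the four cells of the
Venn diagram of X and Y. -/
theorem exists_finset_inter_card {t : ℕ} {X Y : Finset (Fin (2 * t + 1))} (hX : X.card = t)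
    (hY : Y.card = t) {m₁ m₂ : ℕ} (h₁ : m₁ ≤ t) (h₂ : m₂ ≤ t)
    (h₃ : m₁ + (X ∩ Y).card ≤ t + m₂) (h₄ : m₂ + (X ∩ Y).card ≤ t + m₁)
    (h₅ : t ≤ m₁ + m₂ + (X ∩ Y).card + 1) (h₆ : m₁ + m₂ ≤ t + (X ∩ Y).card) :
    ∃ W : Finset (Fin (2 * t + 1)), W.card = t ∧ (X ∩ W).card = m₁ ∧ (W ∩ Y).card = m₂ := by
  set a := (X ∩ Y).card with ha
  have hXY : (X \ Y).card + a = t := by rw [ha, Finset.card_sdiff_add_card_inter, hX]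
  have hYX : (Y \ X).card + a = t := by
    rw [ha, Finset.inter_comm, Finset.card_sdiff_add_card_inter, hY]
  have hU : (X ∪ Y).card + a = 2 * t := by
    rw [ha, Finset.card_union_add_card_inter]; omega
  have hC : ((X ∪ Y)ᶜ).card + (X ∪ Y).card = 2 * t + 1 := by
    rw [Finset.card_compl, Fintype.card_fin]
    have := Finset.card_le_univ (X ∪ Y)
    rw [Fintype.card_fin] at this
    omega
  have ha' : a ≤ t := by omega
  obtain ⟨i, i₁, i₂, i₃, i₄, i₅, i₆, i₇⟩ : ∃ i, m₁ + a ≤ t + i ∧ m₂ + a ≤ t + i ∧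
      m₁ + m₂ ≤ t + i ∧ i ≤ a ∧ i ≤ m₁ ∧ i ≤ m₂ ∧ i + t ≤ m₁ + m₂ + a + 1 := by
    clear hXY hYX hU hC ha hX hY
    -- The least i for which the parts in X \ Y and Y \ X fit and the part outside X ∪ Y has
    -- nonnegative size.
    exact ⟨max (max (m₁ + a - t) (m₂ + a - t)) (m₁ + m₂ - t), by omega⟩
  obtain ⟨I, hI, hIc⟩ := Finset.exists_subset_card_eq (s := X ∩ Y) (n := i) (by omega)
  obtain ⟨J, hJ, hJc⟩ := Finset.exists_subset_card_eq (s := X \ Y) (n := m₁ - i) (by omega)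
  obtain ⟨K, hK, hKc⟩ := Finset.exists_subset_card_eq (s := Y \ X) (n := m₂ - i) (by omega)
  obtain ⟨R, hR, hRc⟩ := Finset.exists_subset_card_eq (s := (X ∪ Y)ᶜ)
    (n := t - i - (m₁ - i) - (m₂ - i)) (by omega)
  have e₁ : X ∩ (I ∪ J ∪ K ∪ R) = I ∪ J := by
    ext x
    clear hIc hJc hKc hRc hU hC hXY hYX ha h₁ h₂ h₃ h₄ h₅ h₆ i₁ i₂ i₃ i₄ i₅ i₆ i₇ hX hY
    grind [Finset.mem_compl]
  have e₂ : (I ∪ J ∪ K ∪ R) ∩ Y = I ∪ K := by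
    ext x
    clear hIc hJc hKc hRc hU hC hXY hYX ha h₁ h₂ h₃ h₄ h₅ h₆ i₁ i₂ i₃ i₄ i₅ i₆ i₇ hX hY
    grind [Finset.mem_compl]
  have d₁ : Disjoint I J := by
    rw [Finset.disjoint_left]; intro x
    clear hIc hJc hKc hRc hU hC hXY hYX ha h₁ h₂ h₃ h₄ h₅ h₆ i₁ i₂ i₃ i₄ i₅ i₆ i₇ hX hY
    grind [Finset.mem_compl]
  have d₂ : Disjoint I K := by
    rw [Finset.disjoint_left]; intro x
    clear hIc hJc hKc hRc hU hC hXY hYX ha h₁ h₂ h₃ h₄ h₅ h₆ i₁ i₂ i₃ i₄ i₅ i₆ i₇ hX hY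
    grind [Finset.mem_compl]
  have d₃ : Disjoint (I ∪ J) K := by
    rw [Finset.disjoint_left]; intro x
    clear hIc hJc hKc hRc hU hC hXY hYX ha h₁ h₂ h₃ h₄ h₅ h₆ i₁ i₂ i₃ i₄ i₅ i₆ i₇ hX hY
    grind [Finset.mem_compl]
  have d₄ : Disjoint (I ∪ J ∪ K) R := by
    rw [Finset.disjoint_left]; intro x
    clear hIc hJc hKc hRc hU hC hXY hYX ha h₁ h₂ h₃ h₄ h₅ h₆ i₁ i₂ i₃ i₄ i₅ i₆ i₇ hX hY
    grind [Finset.mem_compl]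
  refine ⟨I ∪ J ∪ K ∪ R, ?_, ?_, ?_⟩
  · rw [Finset.card_union_of_disjoint d₄, Finset.card_union_of_disjoint d₃,
      Finset.card_union_of_disjoint d₁]
    omega
  · rw [e₁, Finset.card_union_of_disjoint d₁]; omega
  · rw [e₂, Finset.card_union_of_disjoint d₂]; omega

/-- Turns the two bounds on the distance into explicit end points for m, so that the composition of
links becomes linear arithmetic. -/
theorem LinkRel.exists_interval {t ℓ μ : ℕ} (h : ℓ < 2 * t) (hμ : μ ≤ t) (hμ' : μ ≤ ℓ) :
    ∃ p lo hi : ℕ, lo ≤ hi ∧ hi ≤ t ∧ (∀ m, lo ≤ m → m ≤ hi → LinkRel t ℓ μ m) ∧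
      ((ℓ = 2 * p ∧ lo + p = t ∧ (hi = t ∨ hi + μ = t + p)) ∨
        (ℓ = 2 * p + 1 ∧ hi = p ∧ (lo = 0 ∨ lo + p + 1 = μ))) := by
  unfold LinkRel
  rcases Nat.even_or_odd' ℓ with ⟨p, rfl | rfl⟩
  · refine ⟨p, t - p, min t (t + p - μ), by omega, by omega, fun m _ _ ↦ ?_, ?_⟩ <;> omega
  · refine ⟨p, μ - (p + 1), p, by omega, by omega, fun m _ _ ↦ ?_, ?_⟩ <;> omega

/-- Two consecutive links act like one link. -/
theorem LinkRel.exists_between {t : ℕ} {X Y : Finset (Fin (2 * t + 1))} (hX : X.card = t)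
    (hY : Y.card = t) {ℓ₁ ℓ₂ μ₁ μ₂ : ℕ} (h₁ : ℓ₁ < 2 * t) (h₂ : ℓ₂ < 2 * t) (hμ₁ : μ₁ ≤ t)
    (hμ₂ : μ₂ ≤ t) (hμ₁' : μ₁ ≤ ℓ₁) (hμ₂' : μ₂ ≤ ℓ₂)
    (h : LinkRel t (ℓ₁ + ℓ₂) (max μ₁ μ₂) (X ∩ Y).card) :
    ∃ W : Finset (Fin (2 * t + 1)), W.card = t ∧ LinkRel t ℓ₁ μ₁ (X ∩ W).card ∧
      LinkRel t ℓ₂ μ₂ (W ∩ Y).card := by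
  have ha : (X ∩ Y).card ≤ t :=
    (Finset.card_le_card Finset.inter_subset_left).trans_eq hX
  suffices ∃ m₁ m₂ : ℕ, m₁ ≤ t ∧ m₂ ≤ t ∧ m₁ + (X ∩ Y).card ≤ t + m₂ ∧
      m₂ + (X ∩ Y).card ≤ t + m₁ ∧ t ≤ m₁ + m₂ + (X ∩ Y).card + 1 ∧
      m₁ + m₂ ≤ t + (X ∩ Y).card ∧ LinkRel t ℓ₁ μ₁ m₁ ∧ LinkRel t ℓ₂ μ₂ m₂ by
    obtain ⟨m₁, m₂, a₁, a₂, a₃, a₄, a₅, a₆, r₁, r₂⟩ := this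
    obtain ⟨W, hW, rfl, rfl⟩ := exists_finset_inter_card hX hY a₁ a₂ a₃ a₄ a₅ a₆
    exact ⟨W, hW, r₁, r₂⟩
  generalize (X ∩ Y).card = a at *
  obtain ⟨p, lo₁, hi₁, b₁, b₁', r₁, s₁⟩ := LinkRel.exists_interval h₁ hμ₁ hμ₁'
  obtain ⟨q, lo₂, hi₂, b₂, b₂', r₂, s₂⟩ := LinkRel.exists_interval h₂ hμ₂ hμ₂'
  have hμ := le_max_left μ₁ μ₂
  have hμ' := le_max_right μ₁ μ₂
  generalize max μ₁ μ₂ = μ at *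
  -- The conditions that remain after `m₁` and `m₂` are eliminated from the triangle and perimeter
  -- inequalities; the relation for the combined link supplies them.
  have c : lo₁ + a ≤ t + hi₂ ∧ lo₂ + a ≤ t + hi₁ ∧ lo₁ + lo₂ ≤ t + a ∧
      t ≤ hi₁ + hi₂ + a + 1 := by
    unfold LinkRel at h
    clear hX hY r₁ r₂
    rcases s₁ with ⟨rfl, s₁, s₁'⟩ | ⟨rfl, rfl, s₁'⟩ <;>
      rcases s₂ with ⟨rfl, s₂, s₂'⟩ | ⟨rfl, rfl, s₂'⟩ <;>
      rcases s₁' with rfl | s₁' <;> rcases s₂' with rfl | s₂' <;>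
      rcases h with ⟨h₀, h, h'⟩ | ⟨h₀, h, h'⟩ <;> omega
  obtain ⟨c₁, c₂, c₃, c₄⟩ := c
  clear s₁ s₂ h hX hY
  -- Back substitution: the least `m₁` that leaves a nonempty range for `m₂`, then the least `m₂`.
  obtain ⟨m₁, e₁, e₂, e₃, e₄, e₅, e₆⟩ : ∃ m₁, lo₁ ≤ m₁ ∧ m₁ ≤ hi₁ ∧ lo₂ + a ≤ t + m₁ ∧
      m₁ + a ≤ t + hi₂ ∧ t ≤ m₁ + hi₂ + a + 1 ∧ m₁ + lo₂ ≤ t + a :=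
    ⟨max lo₁ (max (lo₂ + a - t) (t - a - 1 - hi₂)), by omega⟩
  obtain ⟨m₂, f₁, f₂, f₃, f₄, f₅, f₆⟩ : ∃ m₂, lo₂ ≤ m₂ ∧ m₂ ≤ hi₂ ∧ m₁ + a ≤ t + m₂ ∧
      m₂ + a ≤ t + m₁ ∧ t ≤ m₁ + m₂ + a + 1 ∧ m₁ + m₂ ≤ t + a :=
    ⟨max lo₂ (max (m₁ + a - t) (t - a - 1 - m₁)), by omega⟩
  exact ⟨m₁, m₂, e₂.trans b₁', f₂.trans b₂', f₃, f₄, f₅, f₆, r₁ _ e₁ e₂, r₂ _ f₁ f₂⟩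

/-- A colour set at one end of a link can be completed to the other end. -/
theorem LinkRel.exists_end {t : ℕ} {X : Finset (Fin (2 * t + 1))} (hX : X.card = t)
    {ℓ μ : ℕ} (h : ℓ < 2 * t) (hμ : μ ≤ ℓ) :
    ∃ W : Finset (Fin (2 * t + 1)), W.card = t ∧ LinkRel t ℓ μ (X ∩ W).card := by
  -- The other end is put at distance exactly ℓ, which meets the lower bound since μ ≤ ℓ.
  obtain ⟨m, hm, hr⟩ : ∃ m ≤ t, LinkRel t ℓ μ m := by
    rcases Nat.even_or_odd' ℓ with ⟨p, hp | hp⟩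
    · exact ⟨t - p, by omega, by unfold LinkRel; omega⟩
    · exact ⟨p, by omega, by unfold LinkRel; omega⟩
  have hs : (X ∩ X).card = t := by rw [Finset.inter_self, hX]
  obtain ⟨W, hW, h₁, -⟩ := exists_finset_inter_card hX hX (m₁ := m) (m₂ := m) hm hm (by omega)
    (by omega) (by omega) (by omega)
  exact ⟨W, hW, h₁ ▸ hr⟩

/-- If the link between two vertices is as tight as possible, then the complementary arc of a
cycle of length `2 t + 1` is tight, too. -/
theorem LinkRel.of_rigid {t ℓ₁ ℓ₂ μ₁ μ₂ m : ℕ} (h : ℓ₁ + ℓ₂ = 2 * t + 1) (hμ₁ : μ₁ ≤ ℓ₁)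
    (hμ₂ : μ₂ ≤ ℓ₂) (hr : LinkRel t ℓ₁ ℓ₁ m) :
    LinkRel t ℓ₁ μ₁ m ∧ LinkRel t ℓ₂ μ₂ m := by
  -- The two distances add up to 2t+1, as do `ℓ₁` and `ℓ₂`, and the two lengths have opposite
  -- parity. Distance `ℓ₁` for one link is thus distance `ℓ₂` for the other, and a fully stretched
  -- link meets every lower bound.
  unfold LinkRel at *; omega

/-! ### A closed walk of 2t+1 colour sets that bisects given sets. -/

/-- As long as at least nine elements remain, two of them share one of the eight classes and can be
split off as a pair. At most seven elements are left, that is, one single element and three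
arbitrary pairs. -/
theorem exists_pairing {α κ : Type*} [DecidableEq α] [Fintype κ] [DecidableEq κ]
    (hκ : Fintype.card κ = 8) (c : α → κ) : ∀ (t : ℕ) (U : Finset α), U.card = 2 * t + 1 →
    ∃ σ : ℕ → α, Set.InjOn σ (Set.Iio (2 * t + 1)) ∧ (∀ n < 2 * t + 1, σ n ∈ U) ∧
      ((Finset.range t).filter fun s ↦ c (σ (2 * s + 1)) ≠ c (σ (2 * s + 2))).card ≤ 3 := by
  intro t
  induction t with
  | zero =>
    intro U hU
    obtain ⟨x, rfl⟩ := Finset.card_eq_one.1 (by simpa using hU)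
    refine ⟨fun _ ↦ x, ?_, by simp, by simp⟩
    intro a ha b hb _
    simp only [Set.mem_Iio] at ha hb
    omega
  | succ t ih =>
    intro U hU
    obtain ⟨x, hx, y, hy, hxy, hc⟩ : ∃ x ∈ U, ∃ y ∈ U, x ≠ y ∧ (3 ≤ t → c x = c y) := by
      by_cases ht : 3 ≤ t
      · obtain ⟨x, hx, y, hy, hxy, hc⟩ := Finset.exists_ne_map_eq_of_card_lt_of_maps_to
          (s := U) (t := (Finset.univ : Finset κ)) (f := c)
          (by rw [Finset.card_univ, hκ]; omega) (fun _ _ ↦ Finset.mem_univ _)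
        exact ⟨x, hx, y, hy, hxy, fun _ ↦ hc⟩
      · obtain ⟨x, hx, y, hy, hxy⟩ := Finset.one_lt_card.1 (show 1 < U.card by omega)
        exact ⟨x, hx, y, hy, hxy, fun h ↦ absurd h ht⟩
    obtain ⟨σ, hσ, hU', hσc⟩ := ih ((U.erase x).erase y) (by
      rw [Finset.card_erase_of_mem (Finset.mem_erase.2 ⟨hxy.symm, hy⟩),
        Finset.card_erase_of_mem hx]
      omega)
    have hne : ∀ n < 2 * t + 1, σ n ≠ y ∧ σ n ≠ x ∧ σ n ∈ U := fun n hn ↦ by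
      simpa [Finset.mem_erase] using hU' n hn
    refine ⟨fun n ↦ if n < 2 * t + 1 then σ n else if n = 2 * t + 1 then x else y, ?_, ?_, ?_⟩
    · intro a ha b hb hab
      simp only [Set.mem_Iio] at ha hb
      dsimp only at hab
      split_ifs at hab with h₁ h₂ h₃ h₄ h₅ h₆ h₇ h₈
      · exact hσ h₁ h₂ hab
      · exact absurd hab (hne a h₁).2.1
      · exact absurd hab (hne a h₁).1
      · exact absurd hab.symm (hne b h₅).2.1
      · omega
      · exact absurd hab hxy
      · exact absurd hab.symm (hne b h₇).1
      · exact absurd hab.symm hxy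
      · omega
    · intro n hn
      dsimp only
      split_ifs with h₁ h₂
      · exact (hne n h₁).2.2
      · exact hx
      · exact hy
    · by_cases ht : 3 ≤ t
      · refine le_trans (Finset.card_le_card ?_) hσc
        intro s hs
        simp only [Finset.mem_filter, Finset.mem_range] at hs ⊢
        have hst : s < t := by
          by_contra hst
          obtain rfl : s = t := by omega
          simp [hc ht] at hs
        refine ⟨hst, ?_⟩
        rw [if_pos (by omega), if_pos (by omega)] at hs
        exact hs.2
      · exact (Finset.card_filter_le _ _).trans (by rw [Finset.card_range]; omega)

/-- Positions in the sequence of colours of the elements of the `j`-th colour set on a cycle of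
length `2 t + 1`. -/
def cyclePos (j s : ℕ) : ℕ :=
  -- Every set takes one position from each pair {2s+1, 2s+2}, except that for odd j the pair s =
  -- j/2 is replaced by position 0. From j to j+2 one pair switches sides: set 0 has all odd
  -- positions and set 2t all positive even ones, so the walk closes up.
  if j % 2 = 0 then if s < j / 2 then 2 * s + 2 else 2 * s + 1
  else if s < j / 2 then 2 * s + 1 else if s = j / 2 then 0 else 2 * s + 2

theorem cyclePos_lt {t j s : ℕ} (hs : s < t) : cyclePos j s < 2 * t + 1 := by
  unfold cyclePos; split_ifs <;> omega

theorem cyclePos_injective (j : ℕ) : Function.Injective (cyclePos j) := by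
  intro a b h
  unfold cyclePos at h
  split_ifs at h <;> omega

theorem cyclePos_ne_succ (j a b : ℕ) : cyclePos j a ≠ cyclePos (j + 1) b := by
  unfold cyclePos
  split_ifs <;> omega

theorem cyclePos_ne_zero {t a b : ℕ} (ha : a < t) : cyclePos (2 * t) a ≠ cyclePos 0 b := by
  unfold cyclePos
  split_ifs <;> omega

section

variable {t : ℕ} {σ : ℕ → Fin (2 * t + 1)}

/-- The `j`-th colour set on a cycle of length `2 t + 1`. -/
def cycleSet (σ : ℕ → Fin (2 * t + 1)) (j : ℕ) : Finset (Fin (2 * t + 1)) :=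
  (Finset.range t).image fun s ↦ σ (cyclePos (j % (2 * t + 1)) s)

theorem injOn_cyclePos (hσ : Set.InjOn σ (Set.Iio (2 * t + 1))) (j : ℕ) :
    Set.InjOn (fun s ↦ σ (cyclePos j s)) (Finset.range t : Set ℕ) := by
  intro a ha b hb h
  simp only [Finset.coe_range, Set.mem_Iio] at ha hb
  exact cyclePos_injective j (hσ (cyclePos_lt ha) (cyclePos_lt hb) h)

theorem card_cycleSet (hσ : Set.InjOn σ (Set.Iio (2 * t + 1))) (j : ℕ) :
    (cycleSet σ j).card = t := by
  rw [cycleSet, Finset.card_image_of_injOn (injOn_cyclePos hσ _), Finset.card_range]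

theorem disjoint_cycleSet_succ (hσ : Set.InjOn σ (Set.Iio (2 * t + 1))) (j : ℕ) :
    Disjoint (cycleSet σ j) (cycleSet σ (j + 1)) := by
  rw [Finset.disjoint_left]
  intro x hx hx'
  simp only [cycleSet, Finset.mem_image, Finset.mem_range] at hx hx'
  obtain ⟨a, ha, rfl⟩ := hx
  obtain ⟨b, hb, h⟩ := hx'
  have h := hσ (cyclePos_lt hb) (cyclePos_lt ha) h
  have hj : j % (2 * t + 1) < 2 * t + 1 := Nat.mod_lt _ (by omega)
  rcases Nat.lt_or_ge (j % (2 * t + 1)) (2 * t) with hlt | hge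
  · have : (j + 1) % (2 * t + 1) = j % (2 * t + 1) + 1 := by
      rw [Nat.add_mod, Nat.mod_eq_of_lt (show 1 < 2 * t + 1 by omega)]
      exact Nat.mod_eq_of_lt (by omega)
    rw [this] at h
    exact cyclePos_ne_succ _ _ _ h.symm
  · have h' : j % (2 * t + 1) = 2 * t := by omega
    have : (j + 1) % (2 * t + 1) = 0 := by
      rw [Nat.add_mod, h', Nat.mod_eq_of_lt (show 1 < 2 * t + 1 by omega), Nat.mod_self]
    rw [this, h'] at h
    exact cyclePos_ne_zero ha h.symm

/-- Y ∪ Z misses a single colour, so X loses at most one element there. -/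
theorem inter_card_of_disjoint {X Y Z : Finset (Fin (2 * t + 1))} (hX : X.card = t)
    (hY : Y.card = t) (hZ : Z.card = t) (h : Disjoint Y Z) :
    (X ∩ Y).card + (X ∩ Z).card ≤ t ∧ t ≤ (X ∩ Y).card + (X ∩ Z).card + 1 := by
  have h₁ : (X ∩ (Y ∪ Z)).card = (X ∩ Y).card + (X ∩ Z).card := by
    rw [Finset.inter_union_distrib_left, Finset.card_union_of_disjoint
      (h.mono Finset.inter_subset_right Finset.inter_subset_right)]
  have h₂ : (Y ∪ Z).card = 2 * t := by rw [Finset.card_union_of_disjoint h]; omega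
  have h₃ := Finset.card_union_add_card_inter X (Y ∪ Z)
  have h₄ := Finset.card_le_univ (X ∪ (Y ∪ Z))
  have h₅ := Finset.card_le_card (Finset.inter_subset_left (s₁ := X) (s₂ := Y ∪ Z))
  rw [Fintype.card_fin] at h₄
  omega

theorem cycleSet_inter_card (hσ : Set.InjOn σ (Set.Iio (2 * t + 1))) (j n : ℕ) :
    (n % 2 = 0 ∧ 2 * t ≤ n + 2 * (cycleSet σ j ∩ cycleSet σ (j + n)).card) ∨
    (n % 2 = 1 ∧ 2 * (cycleSet σ j ∩ cycleSet σ (j + n)).card + 1 ≤ n) := by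
  induction n with
  | zero => left; simp [card_cycleSet hσ]
  | succ n ih =>
    have := inter_card_of_disjoint (card_cycleSet hσ j) (card_cycleSet hσ (j + n))
      (card_cycleSet hσ (j + n + 1)) (disjoint_cycleSet_succ hσ (j + n))
    rw [← add_assoc]
    omega

/-- The two arcs bound the two distances by n and m. Both pairs have sum 2t+1, so equality holds,
and sets n steps apart are at distance exactly n. -/
theorem linkRel_cycleSet (hσ : Set.InjOn σ (Set.Iio (2 * t + 1))) {j n m : ℕ}
    (h : n + m = 2 * t + 1) {μ : ℕ} (hμ : μ ≤ n) :
    LinkRel t n μ (cycleSet σ j ∩ cycleSet σ (j + n)).card := by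
  have h₁ := cycleSet_inter_card hσ j n
  have h₂ := cycleSet_inter_card hσ (j + n) m
  have h₃ : cycleSet σ (j + n + m) = cycleSet σ j := by
    rw [cycleSet, cycleSet, add_assoc, h, Nat.add_mod_right]
  rw [h₃, Finset.inter_comm] at h₂
  unfold LinkRel
  omega

/-- A pair that A does not separate contributes twice as much to A as to its intersection with the
colour set. The error is 1 for position 0, 2 for the exceptional pair j/2, and 1 for each of the at
most c separated pairs. -/
theorem card_le_cycleSet_inter (hσ : Set.InjOn σ (Set.Iio (2 * t + 1)))
    (A : Finset (Fin (2 * t + 1))) {c : ℕ} (hc : ((Finset.range t).filter fun s ↦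
      ¬ (σ (2 * s + 1) ∈ A ↔ σ (2 * s + 2) ∈ A)).card ≤ c) (j : ℕ) :
    A.card ≤ 2 * (cycleSet σ j ∩ A).card + c + 3 := by
  set j' := j % (2 * t + 1)
  have h₁ : A.card = ∑ n ∈ Finset.range (2 * t + 1), if σ n ∈ A then 1 else 0 := by
    rw [← Finset.card_filter, ← Finset.card_image_of_injOn (f := σ)]
    · congr 1
      refine (Finset.eq_of_subset_of_card_le ?_ ?_).symm
      · intro x hx
        obtain ⟨n, hn, rfl⟩ := Finset.mem_image.1 hx
        exact (Finset.mem_filter.1 hn).2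
      · have hs : (Finset.range (2 * t + 1)).image σ = Finset.univ := by
          refine Finset.eq_univ_of_card _ ?_
          rw [Finset.card_image_of_injOn (by simpa using hσ), Finset.card_range, Fintype.card_fin]
        refine Finset.card_le_card fun x hx ↦ ?_
        obtain ⟨n, hn, rfl⟩ := Finset.mem_image.1 (hs ▸ Finset.mem_univ x)
        exact Finset.mem_image.2 ⟨n, Finset.mem_filter.2 ⟨hn, hx⟩, rfl⟩
    · intro a ha b hb h
      simp only [Finset.coe_filter, Finset.mem_range, Set.mem_ofPred_eq] at ha hb
      exact hσ ha.1 hb.1 h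
  have h₂ : ∀ r, ∑ n ∈ Finset.range (2 * r + 1), (if σ n ∈ A then 1 else 0) =
      (if σ 0 ∈ A then 1 else 0) + ∑ s ∈ Finset.range r,
        ((if σ (2 * s + 1) ∈ A then 1 else 0) + if σ (2 * s + 2) ∈ A then 1 else 0) := by
    intro r
    induction r with
    | zero => simp only [mul_zero, zero_add, Finset.sum_range_one, Finset.sum_range_zero, add_zero]
    | succ r ih =>
      rw [Finset.sum_range_succ (n := r), ← add_assoc, ← ih,
        show 2 * (r + 1) + 1 = 2 * r + 1 + 1 + 1 by ring,
        Finset.sum_range_succ, Finset.sum_range_succ]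
      ring_nf
  have h₃ : (cycleSet σ j ∩ A).card =
      ∑ s ∈ Finset.range t, if σ (cyclePos j' s) ∈ A then 1 else 0 := by
    rw [← Finset.card_filter, ← Finset.card_image_of_injOn (f := fun s ↦ σ (cyclePos j' s))
      ((injOn_cyclePos hσ j').mono (Finset.coe_subset.2 (Finset.filter_subset _ _)))]
    congr 1
    ext x
    simp only [cycleSet, Finset.mem_inter, Finset.mem_image, Finset.mem_filter]
    constructor
    · rintro ⟨⟨s, hs, rfl⟩, hx⟩
      exact ⟨s, ⟨hs, hx⟩, rfl⟩
    · rintro ⟨s, ⟨hs, hx⟩, rfl⟩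
      exact ⟨⟨s, hs, rfl⟩, hx⟩
  have h₄ : ∑ s ∈ Finset.range t, (if s = j' / 2 then 2 else 0) ≤ 2 := by
    rw [Finset.sum_ite_eq']
    split_ifs <;> omega
  rw [Finset.card_filter] at hc
  have h₅ : ∑ s ∈ Finset.range t,
        ((if σ (2 * s + 1) ∈ A then 1 else 0) + if σ (2 * s + 2) ∈ A then 1 else 0) ≤
      ∑ s ∈ Finset.range t, (2 * (if σ (cyclePos j' s) ∈ A then 1 else 0) +
        (if ¬ (σ (2 * s + 1) ∈ A ↔ σ (2 * s + 2) ∈ A) then 1 else 0) +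
        (if s = j' / 2 then 2 else 0)) := by
    refine Finset.sum_le_sum fun s _ ↦ ?_
    by_cases hs : s = j' / 2
    · rw [if_pos hs]
      split_ifs <;> omega
    · have : cyclePos j' s = 2 * s + 1 ∨ cyclePos j' s = 2 * s + 2 := by
        unfold cyclePos; split_ifs <;> omega
      rcases this with h | h <;> rw [h] <;> by_cases h₁ : σ (2 * s + 1) ∈ A <;>
        by_cases h₂ : σ (2 * s + 2) ∈ A <;> simp [h₁, h₂, hs]
  conv_rhs at h₅ => rw [Finset.sum_add_distrib, Finset.sum_add_distrib, ← Finset.mul_sum, ← h₃]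
  rw [h₁, h₂]
  split_ifs <;> omega

/-- The estimate for A and for its complement, of size t+1, puts twice the number of common elements
between t-6 and t+5. Both distances are then at most t+6, and large enough for the lower bound, as
2μ-ℓ ≤ t-6. -/
theorem linkRel_cycleSet_inter (hσ : Set.InjOn σ (Set.Iio (2 * t + 1)))
    {A : Finset (Fin (2 * t + 1))} (hA : A.card = t) (hc : ((Finset.range t).filter fun s ↦
      ¬ (σ (2 * s + 1) ∈ A ↔ σ (2 * s + 2) ∈ A)).card ≤ 3) (j : ℕ) {ℓ μ : ℕ} (hℓ : t + 6 ≤ ℓ)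
    (hμ : μ ≤ t) : LinkRel t ℓ μ (cycleSet σ j ∩ A).card := by
  have h₁ := card_le_cycleSet_inter hσ A hc j
  have h₂ := card_le_cycleSet_inter hσ Aᶜ (c := 3) (by simpa [not_iff_not] using hc) j
  have h₃ : (cycleSet σ j ∩ A).card + (cycleSet σ j ∩ Aᶜ).card = t := by
    rw [← Finset.sdiff_eq_inter_compl, Finset.card_inter_add_card_sdiff, card_cycleSet hσ]
  rw [Finset.card_compl, Fintype.card_fin] at h₂
  unfold LinkRel
  omega

end

/-- A cycle of length `2 t + 1` with three exits can be coloured, if the links that leave it are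
long. -/
theorem LinkRel.exists_triangle {t p q r : ℕ} (h : p + q + r = 2 * t + 1)
    {A B C : Finset (Fin (2 * t + 1))} (hA : A.card = t) (hB : B.card = t) (hC : C.card = t)
    {μp μq μr ℓA ℓB ℓC μA μB μC : ℕ} (hμp : μp ≤ p) (hμq : μq ≤ q) (hμr : μr ≤ r)
    (hℓA : t + 6 ≤ ℓA) (hℓB : t + 6 ≤ ℓB) (hℓC : t + 6 ≤ ℓC) (hμA : μA ≤ t) (hμB : μB ≤ t)
    (hμC : μC ≤ t) :
    ∃ X Y Z : Finset (Fin (2 * t + 1)), X.card = t ∧ Y.card = t ∧ Z.card = t ∧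
      LinkRel t p μp (X ∩ Y).card ∧ LinkRel t q μq (Y ∩ Z).card ∧ LinkRel t r μr (Z ∩ X).card ∧
      LinkRel t ℓA μA (X ∩ A).card ∧ LinkRel t ℓB μB (Y ∩ B).card ∧
      LinkRel t ℓC μC (Z ∩ C).card := by
  -- Classifying colours by membership in A, B and C makes one ordering serve all three sets; X, Y,
  -- Z are then the sets number 0, p and p+q of the walk.
  obtain ⟨σ, hσ, -, hc⟩ := exists_pairing (κ := Bool × Bool × Bool) (by simp)
    (fun x ↦ (decide (x ∈ A), decide (x ∈ B), decide (x ∈ C))) t Finset.univ (by simp)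
  have hcA : ((Finset.range t).filter fun s ↦
      ¬ (σ (2 * s + 1) ∈ A ↔ σ (2 * s + 2) ∈ A)).card ≤ 3 := by
    refine (Finset.card_le_card fun s hs ↦ ?_).trans hc
    simp only [Finset.mem_filter, ne_eq, Prod.mk.injEq, decide_eq_decide] at hs ⊢
    tauto
  have hcB : ((Finset.range t).filter fun s ↦
      ¬ (σ (2 * s + 1) ∈ B ↔ σ (2 * s + 2) ∈ B)).card ≤ 3 := by
    refine (Finset.card_le_card fun s hs ↦ ?_).trans hc
    simp only [Finset.mem_filter, ne_eq, Prod.mk.injEq, decide_eq_decide] at hs ⊢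
    tauto
  have hcC : ((Finset.range t).filter fun s ↦
      ¬ (σ (2 * s + 1) ∈ C ↔ σ (2 * s + 2) ∈ C)).card ≤ 3 := by
    refine (Finset.card_le_card fun s hs ↦ ?_).trans hc
    simp only [Finset.mem_filter, ne_eq, Prod.mk.injEq, decide_eq_decide] at hs ⊢
    tauto
  have hX : cycleSet σ (0 + p + q + r) = cycleSet σ 0 := by
    rw [cycleSet, cycleSet, zero_add, h, Nat.mod_self, Nat.zero_mod]
  refine ⟨cycleSet σ 0, cycleSet σ (0 + p), cycleSet σ (0 + p + q), card_cycleSet hσ _,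
    card_cycleSet hσ _, card_cycleSet hσ _, ?_, ?_, ?_, ?_, ?_, ?_⟩
  · exact linkRel_cycleSet hσ (m := q + r) (by omega) hμp
  · exact linkRel_cycleSet hσ (m := p + r) (by omega) hμq
  · rw [← hX]
    exact linkRel_cycleSet hσ (m := p + q) (by omega) hμr
  · exact linkRel_cycleSet_inter hσ hA hcA _ hℓA hμA
  · exact linkRel_cycleSet_inter hσ hB hcB _ hℓB hμB
  · exact linkRel_cycleSet_inter hσ hC hcC _ hℓC hμC

/-! ### Link graphs and their cycle space over the field with two elements. -/

/-- A multigraph whose edges are links: an edge of length `len e`, whose longest rigid step is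
`step e`, restricts the number of common colours of its ends by `LinkRel`. Only the edges in the
finite set `edges` are present. -/
structure LinkGraph (V E : Type*) where
  src : E → V
  tgt : E → V
  edges : Finset E
  len : E → ℕ
  step : E → ℕ

theorem ZMod.two_eq_one_of_ne_zero : ∀ {a : ZMod 2}, a ≠ 0 → a = 1 := by decide

theorem add_self_eq_zero_of_zmod_two {E : Type*} (z : E → ZMod 2) : z + z = 0 := by
  funext e
  exact CharTwo.add_self_eq_zero (z e)

/-- The support of a vector over the field with two elements. -/
def vecSupp {E : Type*} [Fintype E] (z : E → ZMod 2) : Finset E :=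
  Finset.univ.filter fun e ↦ z e ≠ 0

section

variable {E : Type*} [Fintype E]

@[simp]
theorem mem_vecSupp {z : E → ZMod 2} {e : E} : e ∈ vecSupp z ↔ z e ≠ 0 := by simp [vecSupp]

theorem vecSupp_injective : Function.Injective (vecSupp : (E → ZMod 2) → Finset E) := by
  intro y z h
  funext e
  have h' := Finset.ext_iff.1 h e
  rw [mem_vecSupp, mem_vecSupp] at h'
  by_cases hz : z e = 0
  · rw [hz]; by_contra hy; exact h'.1 hy hz
  · rw [ZMod.two_eq_one_of_ne_zero hz, ZMod.two_eq_one_of_ne_zero (h'.2 hz)]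

theorem vecSupp_add [DecidableEq E] (y z : E → ZMod 2) :
    vecSupp (y + z) = symmDiff (vecSupp y) (vecSupp z) := by
  ext e
  simp only [Finset.mem_symmDiff, mem_vecSupp, Pi.add_apply]
  generalize y e = a
  generalize z e = b
  revert a b
  decide

theorem vecSupp_eq_empty {z : E → ZMod 2} : vecSupp z = ∅ ↔ z = 0 := by
  constructor
  · intro h
    exact vecSupp_injective (h.trans (by ext; simp))
  · rintro rfl; ext; simp

end

namespace LinkGraph

variable {V E : Type*} [Fintype E]

/-- The total length of the edges in the support of a vector. -/
def length (N : LinkGraph V E) (z : E → ZMod 2) : ℕ := ∑ e ∈ vecSupp z, N.len e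

theorem length_add_of_subset [DecidableEq E] (N : LinkGraph V E) {y z : E → ZMod 2}
    (h : vecSupp y ⊆ vecSupp z) : N.length (z + y) + N.length y = N.length z := by
  rw [length, length, length, vecSupp_add, symmDiff_of_ge h, Finset.sum_sdiff h]

variable [DecidableEq V]

/-- The incidence number of an edge and a vertex modulo two. -/
def inc (N : LinkGraph V E) (e : E) (v : V) : ZMod 2 :=
  (if N.src e = v then 1 else 0) + (if N.tgt e = v then 1 else 0)

/-- The cycle space over the field with two elements. -/
def cycleSpace (N : LinkGraph V E) : Submodule (ZMod 2) (E → ZMod 2) where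
  carrier := {z | (∀ e ∉ N.edges, z e = 0) ∧ ∀ v, ∑ e, z e * N.inc e v = 0}
  add_mem' := by
    rintro y z ⟨hy, hy'⟩ ⟨hz, hz'⟩
    refine ⟨fun e he ↦ by simp [hy e he, hz e he], fun v ↦ ?_⟩
    simp [add_mul, Finset.sum_add_distrib, hy', hz']
  zero_mem' := by simp
  smul_mem' := by
    rintro c z ⟨hz, hz'⟩
    refine ⟨fun e he ↦ by simp [hz e he], fun v ↦ ?_⟩
    simp [mul_assoc, ← Finset.mul_sum, hz']

theorem mem_cycleSpace {N : LinkGraph V E} {z : E → ZMod 2} : z ∈ N.cycleSpace ↔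
    (∀ e ∉ N.edges, z e = 0) ∧ ∀ v, ∑ e, z e * N.inc e v = 0 := Iff.rfl

/-- A cycle is a nonzero vector of the cycle space of minimal support. -/
def IsCycle (N : LinkGraph V E) (z : E → ZMod 2) : Prop :=
  z ∈ N.cycleSpace ∧ z ≠ 0 ∧ ∀ y ∈ N.cycleSpace, y ≠ 0 → vecSupp y ⊆ vecSupp z → y = z

/-- MacLane's planarity criterion: the cycle space is spanned by a family that covers every edge
at most twice. -/
def IsFlat (N : LinkGraph V E) : Prop :=
  ∃ F : Finset (E → ZMod 2), Submodule.span (ZMod 2) (F : Set (E → ZMod 2)) = N.cycleSpace ∧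
    ∀ e, (F.filter fun C ↦ C e ≠ 0).card ≤ 2

/-- The hypotheses under which a link graph is shown to be colourable. -/
structure Admissible (N : LinkGraph V E) (t : ℕ) : Prop where
  one_le_len : ∀ e ∈ N.edges, 1 ≤ N.len e
  step_le : ∀ e ∈ N.edges, N.step e ≤ t
  step_le_len : ∀ e ∈ N.edges, N.step e ≤ N.len e
  flat : N.IsFlat
  length_cycle : ∀ z, N.IsCycle z →
    N.length z = 2 * t + 1 ∨ 22 * (2 * t + 1) < 3 * N.length z

/-- A colouring by `t`-subsets of a set with `2 t + 1` elements that respects all links. -/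
def Colorable (N : LinkGraph V E) (t : ℕ) : Prop :=
  ∃ φ : V → Finset (Fin (2 * t + 1)), (∀ v, (φ v).card = t) ∧
    ∀ e ∈ N.edges, LinkRel t (N.len e) (N.step e) (φ (N.src e) ∩ φ (N.tgt e)).card

theorem exists_isCycle_subset {N : LinkGraph V E} {z : E → ZMod 2} (hz : z ∈ N.cycleSpace)
    (hz₀ : z ≠ 0) : ∃ y, N.IsCycle y ∧ vecSupp y ⊆ vecSupp z := by
  induction h : (vecSupp z).card using Nat.strong_induction_on generalizing z with
  | _ n ih =>
    by_cases hc : N.IsCycle z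
    · exact ⟨z, hc, subset_rfl⟩
    · obtain ⟨y, hy, hy₀, hs, hne⟩ : ∃ y ∈ N.cycleSpace, y ≠ 0 ∧ vecSupp y ⊆ vecSupp z ∧ y ≠ z := by
        by_contra! hcon
        exact hc ⟨hz, hz₀, hcon⟩
      have hlt : (vecSupp y).card < n := h ▸ Finset.card_lt_card
        (hs.ssubset_of_ne fun h ↦ hne (vecSupp_injective h))
      obtain ⟨x, hx, hxs⟩ := ih _ hlt hy hy₀ rfl
      exact ⟨x, hx, hxs.trans hs⟩

theorem Admissible.le_length {N : LinkGraph V E} {t : ℕ} (hN : N.Admissible t) {z : E → ZMod 2}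
    (hz : z ∈ N.cycleSpace) (hz₀ : z ≠ 0) : 2 * t + 1 ≤ N.length z := by
  obtain ⟨y, hy, hs⟩ := exists_isCycle_subset hz hz₀
  have h₁ := hN.length_cycle y hy
  have h₂ : N.length y ≤ N.length z := Finset.sum_le_sum_of_subset hs
  omega

/-- Splitting off a cycle inside the support leaves a cycle-space vector supported on the rest, so
the cycles obtained have disjoint supports. Disjointness preserves the covering bound when this is
applied to each member of a MacLane family. -/
theorem exists_decomposition {N : LinkGraph V E} {z : E → ZMod 2} (hz : z ∈ N.cycleSpace) :
    ∃ P : Finset (E → ZMod 2), (∀ p ∈ P, N.IsCycle p) ∧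
      z ∈ Submodule.span (ZMod 2) (P : Set (E → ZMod 2)) ∧
      ∀ e, (P.filter fun p ↦ p e ≠ 0).card ≤ if z e ≠ 0 then 1 else 0 := by
  classical
  induction h : (vecSupp z).card using Nat.strong_induction_on generalizing z with
  | _ n ih =>
    by_cases hz₀ : z = 0
    · exact ⟨∅, by simp, by simp [hz₀], by simp⟩
    obtain ⟨y, hy, hys⟩ := exists_isCycle_subset hz hz₀
    have hsupp : vecSupp (z + y) = vecSupp z \ vecSupp y := by
      rw [vecSupp_add, symmDiff_of_ge hys]
    have hlt : (vecSupp (z + y)).card < n := by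
      rw [hsupp, ← h]
      refine Finset.card_lt_card (Finset.sdiff_ssubset hys ?_)
      rw [Finset.nonempty_iff_ne_empty, Ne, vecSupp_eq_empty]
      exact hy.2.1
    obtain ⟨P, hP, hspan, hcov⟩ := ih _ hlt (N.cycleSpace.add_mem hz hy.1) rfl
    refine ⟨insert y P, ?_, ?_, fun e ↦ ?_⟩
    · intro p hp
      rcases Finset.mem_insert.1 hp with rfl | hp
      · exact hy
      · exact hP p hp
    · have h₁ : z = (z + y) + y := by rw [add_assoc, add_self_eq_zero_of_zmod_two, add_zero]
      rw [h₁]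
      refine Submodule.add_mem _ (Submodule.span_mono ?_ hspan) (Submodule.subset_span ?_) <;> simp
    · have he := Finset.ext_iff.1 hsupp e
      simp only [mem_vecSupp, Finset.mem_sdiff] at he
      have hye := @hys e
      simp only [mem_vecSupp] at hye
      have hc := hcov e
      rw [Finset.filter_insert]
      by_cases hy' : y e = 0
      · rw [if_neg (by simpa using hy')]
        simpa [hy'] using hc
      · rw [if_pos hy', if_pos (hye hy')]
        rw [if_neg (fun h' ↦ (he.1 h').2 hy')] at hc
        exact (Finset.card_insert_le _ _).trans (by omega)

/-- The members of the family in MacLane's criterion can be chosen to be cycles. -/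
theorem IsFlat.exists_cycles {N : LinkGraph V E} (h : N.IsFlat) :
    ∃ F : Finset (E → ZMod 2), Submodule.span (ZMod 2) (F : Set (E → ZMod 2)) = N.cycleSpace ∧
      (∀ C ∈ F, N.IsCycle C) ∧ ∀ e, (F.filter fun C ↦ C e ≠ 0).card ≤ 2 := by
  classical
  obtain ⟨F, hF, hcov⟩ := h
  have hmem : ∀ C ∈ F, C ∈ N.cycleSpace := fun C hC ↦ hF ▸ Submodule.subset_span hC
  have hP : ∀ C : E → ZMod 2, ∃ P : Finset (E → ZMod 2), C ∈ F → (∀ p ∈ P, N.IsCycle p) ∧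
      C ∈ Submodule.span (ZMod 2) (P : Set (E → ZMod 2)) ∧
      ∀ e, (P.filter fun p ↦ p e ≠ 0).card ≤ if C e ≠ 0 then 1 else 0 := by
    intro C
    by_cases hC : C ∈ F
    · obtain ⟨P, hP⟩ := exists_decomposition (hmem C hC)
      exact ⟨P, fun _ ↦ hP⟩
    · exact ⟨∅, fun h ↦ absurd h hC⟩
  choose P hP using hP
  refine ⟨F.biUnion P, le_antisymm ?_ ?_, ?_, fun e ↦ ?_⟩
  · rw [Submodule.span_le]
    intro p hp
    obtain ⟨C, hC, hp⟩ := Finset.mem_biUnion.1 hp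
    exact ((hP C hC).1 p hp).1
  · rw [← hF, Submodule.span_le]
    intro C hC
    refine Submodule.span_mono ?_ (hP C hC).2.1
    exact_mod_cast Finset.subset_biUnion_of_mem P hC
  · intro p hp
    obtain ⟨C, hC, hp⟩ := Finset.mem_biUnion.1 hp
    exact (hP C hC).1 p hp
  · rw [Finset.filter_biUnion]
    calc _ ≤ ∑ C ∈ F, ((P C).filter fun p ↦ p e ≠ 0).card := Finset.card_biUnion_le
      _ ≤ ∑ C ∈ F, if C e ≠ 0 then 1 else 0 := Finset.sum_le_sum fun C hC ↦ (hP C hC).2.2 e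
      _ ≤ 2 := by rw [← Finset.card_filter]; exact hcov e

/-! ### Deletion of edges. -/

/-- Deletion of edges. -/
@[simps]
def restrict (N : LinkGraph V E) (S : Finset E) : LinkGraph V E where
  src := N.src
  tgt := N.tgt
  edges := S
  len := N.len
  step := N.step

theorem mem_cycleSpace_restrict {N : LinkGraph V E} {S : Finset E} (hS : S ⊆ N.edges)
    {z : E → ZMod 2} :
    z ∈ (N.restrict S).cycleSpace ↔ z ∈ N.cycleSpace ∧ ∀ e ∉ S, z e = 0 := by
  simp only [mem_cycleSpace, restrict_edges]
  constructor
  · rintro ⟨h, h'⟩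
    exact ⟨⟨fun e he ↦ h e fun h ↦ he (hS h), h'⟩, h⟩
  · rintro ⟨⟨-, h'⟩, h⟩
    exact ⟨h, h'⟩

theorem IsCycle.of_restrict {N : LinkGraph V E} {S : Finset E} (hS : S ⊆ N.edges)
    {z : E → ZMod 2} (hz : (N.restrict S).IsCycle z) : N.IsCycle z := by
  obtain ⟨h, h₀, hmin⟩ := hz
  rw [mem_cycleSpace_restrict hS] at h
  refine ⟨h.1, h₀, fun y hy hy₀ hs ↦ hmin y ?_ hy₀ hs⟩
  rw [mem_cycleSpace_restrict hS]
  refine ⟨hy, fun e he ↦ ?_⟩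
  by_contra hye
  exact (mem_vecSupp.1 (hs (mem_vecSupp.2 hye))) (h.2 e he)

/-- Deleting e merges the two faces at e: one member `C₀` through e is dropped and added to the
other member through e, if there is one. The map `T` does this linearly and fixes all vectors that
vanish at e. On an edge of `C₀` at most one other member was present, and at most one more is
created. -/
theorem IsFlat.restrict_erase [DecidableEq E] {N : LinkGraph V E} (h : N.IsFlat) (e : E) :
    (N.restrict (N.edges.erase e)).IsFlat := by
  classical
  obtain ⟨F, hF, hcov⟩ := h
  have hmem : ∀ C ∈ F, C ∈ N.cycleSpace := fun C hC ↦ hF ▸ Submodule.subset_span hC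
  have key : ∀ z, z ∈ (N.restrict (N.edges.erase e)).cycleSpace ↔ z ∈ N.cycleSpace ∧ z e = 0 := by
    intro z
    rw [mem_cycleSpace_restrict (Finset.erase_subset _ _)]
    constructor
    · rintro ⟨h, h'⟩
      exact ⟨h, h' e (Finset.notMem_erase _ _)⟩
    · rintro ⟨h, h'⟩
      refine ⟨h, fun f hf ↦ ?_⟩
      by_cases hfe : f = e
      · rw [hfe, h']
      · exact h.1 f fun hf' ↦ hf (Finset.mem_erase.2 ⟨hfe, hf'⟩)
  by_cases hex : ∃ C₀ ∈ F, C₀ e ≠ 0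
  · obtain ⟨C₀, hC₀, hC₀e⟩ := hex
    have hone := ZMod.two_eq_one_of_ne_zero hC₀e
    let T : (E → ZMod 2) →ₗ[ZMod 2] (E → ZMod 2) :=
      LinearMap.id + (LinearMap.proj e).smulRight C₀
    have hT : ∀ z, T z = z + z e • C₀ := fun z ↦ by simp [T]
    have hTC₀ : T C₀ = 0 := by
      rw [hT, hone, one_smul, add_self_eq_zero_of_zmod_two]
    refine ⟨(F.erase C₀).image T, le_antisymm ?_ ?_, fun f ↦ ?_⟩
    · rw [Submodule.span_le]
      intro C hC
      obtain ⟨D, hD, rfl⟩ := Finset.mem_image.1 hC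
      have hD := hmem D (Finset.mem_of_mem_erase hD)
      rw [SetLike.mem_coe, key, hT]
      refine ⟨N.cycleSpace.add_mem hD (N.cycleSpace.smul_mem _ (hmem _ hC₀)), ?_⟩
      simp [hone, CharTwo.add_self_eq_zero]
    · intro z hz
      rw [key, ← hF] at hz
      have h₁ : T z ∈ Submodule.span (ZMod 2) (T '' F) := by
        rw [← Submodule.map_span]
        exact Submodule.mem_map_of_mem hz.1
      rw [hT, hz.2, zero_smul, add_zero] at h₁
      refine Submodule.span_le.2 ?_ h₁
      rintro _ ⟨D, hD, rfl⟩
      by_cases h : D = C₀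
      · rw [h, hTC₀]; exact Submodule.zero_mem _
      · exact Submodule.subset_span (Finset.mem_coe.2 (Finset.mem_image_of_mem _
          (Finset.mem_erase.2 ⟨h, hD⟩)))
    · rw [Finset.filter_image]
      refine Finset.card_image_le.trans ?_
      by_cases hf : C₀ f = 0
      · refine (Finset.card_le_card fun D hD ↦ ?_).trans (hcov f)
        rw [Finset.mem_filter, hT] at hD
        refine Finset.mem_filter.2 ⟨Finset.mem_of_mem_erase hD.1, ?_⟩
        simpa [hf] using hD.2
      · have h₁ : ∀ g, C₀ g ≠ 0 → ((F.erase C₀).filter fun C ↦ C g ≠ 0).card ≤ 1 := by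
          intro g hg
          have := hcov g
          rw [← Finset.insert_erase hC₀, Finset.filter_insert, if_pos hg,
            Finset.card_insert_of_notMem (by simp)] at this
          omega
        have h₂ : ((F.erase C₀).filter fun D ↦ T D f ≠ 0) ⊆
            ((F.erase C₀).filter fun C ↦ C f ≠ 0) ∪ ((F.erase C₀).filter fun C ↦ C e ≠ 0) := by
          intro D hD
          rw [Finset.mem_filter, hT] at hD
          rw [Finset.mem_union, Finset.mem_filter, Finset.mem_filter]
          by_contra hcon
          push Not at hcon
          exact hD.2 (by simp [hcon.1 hD.1, hcon.2 hD.1])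
        refine (Finset.card_le_card h₂).trans ((Finset.card_union_le _ _).trans ?_)
        have := h₁ f hf
        have := h₁ e hC₀e
        omega
  · push Not at hex
    refine ⟨F, ?_, hcov⟩
    rw [hF]
    ext z
    rw [key, iff_self_and]
    intro hz
    rw [← hF] at hz
    have : Submodule.span (ZMod 2) (F : Set (E → ZMod 2)) ≤
        LinearMap.ker (LinearMap.proj e : (E → ZMod 2) →ₗ[ZMod 2] ZMod 2) := by
      rw [Submodule.span_le]
      intro C hC
      simpa using hex C hC
    simpa using this hz

theorem IsFlat.restrict [DecidableEq E] {N : LinkGraph V E} (h : N.IsFlat) {S : Finset E}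
    (hS : S ⊆ N.edges) : (N.restrict S).IsFlat := by
  induction hn : (N.edges \ S).card generalizing N with
  | zero =>
    rw [Finset.card_eq_zero, Finset.sdiff_eq_empty_iff_subset] at hn
    rw [hS.antisymm hn]
    exact h
  | succ n ih =>
    obtain ⟨e, he⟩ := Finset.card_pos.1 (show 0 < (N.edges \ S).card by omega)
    have he' := Finset.mem_sdiff.1 he
    refine ih (N := N.restrict (N.edges.erase e)) (h.restrict_erase e) (fun f hf ↦ ?_) ?_
    · refine Finset.mem_erase.2 ⟨?_, hS hf⟩
      rintro rfl
      exact he'.2 hf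
    · rw [restrict_edges, Finset.erase_sdiff_comm, Finset.card_erase_of_mem he, hn]
      rfl

theorem Admissible.restrict [DecidableEq E] {N : LinkGraph V E} {t : ℕ} (h : N.Admissible t)
    {S : Finset E} (hS : S ⊆ N.edges) : (N.restrict S).Admissible t where
  one_le_len e he := h.one_le_len e (hS he)
  step_le e he := h.step_le e (hS he)
  step_le_len e he := h.step_le_len e (hS he)
  flat := h.flat.restrict hS
  length_cycle z hz := h.length_cycle z (hz.of_restrict hS)

/-! ### Incidences and the suppression of a vertex of degree two. -/

section Joins

variable {V E : Type*}

/-- The edge `e` joins `u` and `v`. -/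
def Joins (N : LinkGraph V E) (e : E) (u v : V) : Prop :=
  (N.src e = u ∧ N.tgt e = v) ∨ (N.src e = v ∧ N.tgt e = u)

theorem Joins.symm {N : LinkGraph V E} {e : E} {u v : V} (h : N.Joins e u v) : N.Joins e v u :=
  Or.symm h

theorem joins_src_tgt (N : LinkGraph V E) (e : E) : N.Joins e (N.src e) (N.tgt e) :=
  Or.inl ⟨rfl, rfl⟩

theorem Joins.inter_card {N : LinkGraph V E} {e : E} {u v : V} (h : N.Joins e u v) {α : Type*}
    [DecidableEq α] (φ : V → Finset α) :
    (φ (N.src e) ∩ φ (N.tgt e)).card = (φ u ∩ φ v).card := by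
  rcases h with ⟨rfl, rfl⟩ | ⟨rfl, rfl⟩
  · rfl
  · rw [Finset.inter_comm]

variable [DecidableEq V]

/-- The edges at a vertex. -/
def star (N : LinkGraph V E) (v : V) : Finset E :=
  N.edges.filter fun e ↦ N.src e = v ∨ N.tgt e = v

theorem mem_star {N : LinkGraph V E} {v : V} {e : E} :
    e ∈ N.star v ↔ e ∈ N.edges ∧ (N.src e = v ∨ N.tgt e = v) := Finset.mem_filter

theorem exists_joins_of_mem_star {N : LinkGraph V E} {v : V} {e : E} (h : e ∈ N.star v) :
    ∃ u, N.Joins e v u := by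
  rcases (mem_star.1 h).2 with h | h
  · exact ⟨_, Or.inl ⟨h, rfl⟩⟩
  · exact ⟨_, Or.inr ⟨rfl, h⟩⟩

theorem Joins.mem_star {N : LinkGraph V E} {e : E} {u v : V} (h : N.Joins e u v)
    (he : e ∈ N.edges) : e ∈ N.star u := by
  refine LinkGraph.mem_star.2 ⟨he, ?_⟩
  rcases h with h | h
  · exact Or.inl h.1
  · exact Or.inr h.2

theorem Joins.inc_eq {N : LinkGraph V E} {e : E} {u v : V} (h : N.Joins e u v) (w : V) :
    N.inc e w = (if u = w then 1 else 0) + (if v = w then 1 else 0) := by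
  rcases h with ⟨rfl, rfl⟩ | ⟨rfl, rfl⟩
  · rfl
  · rw [inc, add_comm]

theorem inc_eq_zero {N : LinkGraph V E} {e : E} {v : V} (he : e ∈ N.edges) (h : e ∉ N.star v) :
    N.inc e v = 0 := by
  rw [LinkGraph.mem_star] at h
  push Not at h
  simp [inc, (h he).1, (h he).2]

end Joins

section

variable {V E : Type*} [DecidableEq E]

/-- Replace two edges in series by one edge from `x` to `y`. -/
def merge (N : LinkGraph V E) (a b : E) (x y : V) : LinkGraph V E where
  src := Function.update N.src a x
  tgt := Function.update N.tgt a y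
  edges := N.edges.erase b
  len := Function.update N.len a (N.len a + N.len b)
  step := Function.update N.step a (max (N.step a) (N.step b))

variable {N : LinkGraph V E} {a b : E} {x y : V}

theorem merge_src : (N.merge a b x y).src = Function.update N.src a x := rfl

theorem merge_tgt : (N.merge a b x y).tgt = Function.update N.tgt a y := rfl

theorem merge_len : (N.merge a b x y).len = Function.update N.len a (N.len a + N.len b) := rfl

theorem merge_step :
    (N.merge a b x y).step = Function.update N.step a (max (N.step a) (N.step b)) := rfl

end

variable {V E : Type*} [Fintype E]

theorem length_eq_sum (N : LinkGraph V E) (z : E → ZMod 2) :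
    N.length z = ∑ e, if z e ≠ 0 then N.len e else 0 := by
  rw [length, vecSupp, Finset.sum_filter]

variable [DecidableEq V] [DecidableEq E]

theorem vertex_sum_eq {N : LinkGraph V E} {z : E → ZMod 2} (hz : ∀ e ∉ N.edges, z e = 0) (v : V) :
    ∑ e, z e * N.inc e v = ∑ e ∈ N.star v, z e * N.inc e v := by
  refine (Finset.sum_subset (Finset.subset_univ _) fun e _ he ↦ ?_).symm
  by_cases h : e ∈ N.edges
  · rw [inc_eq_zero h he, mul_zero]
  · rw [hz e h, zero_mul]

theorem sum_eq_add_add_sum_erase {M : Type*} [AddCommMonoid M] {a b : E} (h : a ≠ b) (g : E → M) :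
    ∑ e, g e = g a + (g b + ∑ e ∈ (Finset.univ.erase a).erase b, g e) := by
  rw [Finset.add_sum_erase _ _ (Finset.mem_erase.2 ⟨h.symm, Finset.mem_univ _⟩),
    Finset.add_sum_erase _ _ (Finset.mem_univ _)]

/-! ### Reducible configurations. -/

theorem colorable_of_two_mul_le {N : LinkGraph V E} {t : ℕ} (hN : N.Admissible t)
    (ih : ∀ M : LinkGraph V E, M.edges.card < N.edges.card → M.Admissible t → M.Colorable t)
    {e : E} (he : e ∈ N.edges) (hlen : 2 * t ≤ N.len e) : N.Colorable t := by
  obtain ⟨φ, hφ, h⟩ := ih (N.restrict (N.edges.erase e)) (Finset.card_erase_lt_of_mem he)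
    (hN.restrict (Finset.erase_subset _ _))
  refine ⟨φ, hφ, fun f hf ↦ ?_⟩
  by_cases hfe : f = e
  · subst hfe
    exact linkRel_of_two_mul_le hlen (hN.step_le _ hf)
      ((Finset.card_le_card Finset.inter_subset_left).trans_eq (hφ _))
  · exact h f (Finset.mem_erase.2 ⟨hfe, hf⟩)

/-- A loop would be a cycle of length below 2t. -/
theorem Admissible.src_ne_tgt {N : LinkGraph V E} {t : ℕ} (hN : N.Admissible t)
    (hlen : ∀ e ∈ N.edges, N.len e < 2 * t) {e : E} (he : e ∈ N.edges) : N.src e ≠ N.tgt e := by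
  intro hloop
  have hc : N.IsCycle (Pi.single e 1) := by
    refine ⟨⟨fun f hf ↦ Pi.single_eq_of_ne (ne_of_mem_of_not_mem he hf).symm _, fun v ↦ ?_⟩,
    by simp, ?_⟩
    · rw [Finset.sum_eq_single e]
      · rw [inc, hloop, CharTwo.add_self_eq_zero, mul_zero]
      · intro f _ hf
        rw [Pi.single_eq_of_ne hf, zero_mul]
      · simp
    · intro y _ hy₀ hs
      refine vecSupp_injective (hs.antisymm fun f hf ↦ ?_)
      obtain rfl : f = e := by
        by_contra hfe
        exact mem_vecSupp.1 hf (Pi.single_eq_of_ne hfe _)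
      obtain ⟨g, hg⟩ := Finset.nonempty_iff_ne_empty.2 (mt vecSupp_eq_empty.1 hy₀)
      obtain rfl : g = f := by
        by_contra hfe
        exact mem_vecSupp.1 (hs hg) (Pi.single_eq_of_ne hfe _)
      exact hg
  have hl : N.length (Pi.single e 1) = N.len e := by
    rw [length_eq_sum, Finset.sum_eq_single e]
    · simp
    · intro f _ hf
      rw [Pi.single_eq_of_ne hf, if_neg (by simp)]
    · simp
  have := hN.length_cycle _ hc
  have := hlen e he
  omega

theorem Admissible.joins_ne {N : LinkGraph V E} {t : ℕ} (hN : N.Admissible t)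
    (hlen : ∀ e ∈ N.edges, N.len e < 2 * t) {e : E} (he : e ∈ N.edges) {u v : V}
    (h : N.Joins e u v) : u ≠ v := by
  have := hN.src_ne_tgt hlen he
  rcases h with ⟨rfl, rfl⟩ | ⟨rfl, rfl⟩
  · exact this
  · exact this.symm

theorem colorable_of_star_eq_singleton {N : LinkGraph V E} {t : ℕ} (hN : N.Admissible t)
    (ih : ∀ M : LinkGraph V E, M.edges.card < N.edges.card → M.Admissible t → M.Colorable t)
    (hlen : ∀ e ∈ N.edges, N.len e < 2 * t) {v : V} {e : E} (hv : N.star v = {e}) :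
    N.Colorable t := by
  have hev : e ∈ N.star v := by simp [hv]
  have he := (mem_star.1 hev).1
  obtain ⟨u, hu⟩ := exists_joins_of_mem_star hev
  have huv := hN.joins_ne hlen he hu
  obtain ⟨φ, hφ, h⟩ := ih (N.restrict (N.edges.erase e)) (Finset.card_erase_lt_of_mem he)
    (hN.restrict (Finset.erase_subset _ _))
  obtain ⟨W, hW, hWr⟩ := LinkRel.exists_end (hφ u) (hlen e he) (hN.step_le_len e he)
  refine ⟨Function.update φ v W, fun w ↦ ?_, fun f hf ↦ ?_⟩
  · by_cases hw : w = v
    · rw [hw, Function.update_self, hW]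
    · rw [Function.update_of_ne hw, hφ]
  · by_cases hfe : f = e
    · subst hfe
      rw [hu.symm.inter_card, Function.update_self, Function.update_of_ne huv.symm]
      exact hWr
    · have hfv : f ∉ N.star v := by simpa [hv] using hfe
      rw [mem_star] at hfv
      push Not at hfv
      rw [Function.update_of_ne (hfv hf).1, Function.update_of_ne (hfv hf).2]
      exact h f (Finset.mem_erase.2 ⟨hfe, hf⟩)

section Merge

variable {N : LinkGraph V E} {a b : E} {v x y : V}

theorem vertex_sum_merge (hab : a ≠ b) (ha : N.Joins a v x) (hb : N.Joins b v y)
    {z : E → ZMod 2} (hz : z a = z b) (w : V) :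
    ∑ e, (Function.update z b 0) e * (N.merge a b x y).inc e w = ∑ e, z e * N.inc e w := by
  rw [sum_eq_add_add_sum_erase hab, sum_eq_add_add_sum_erase hab (fun e ↦ z e * N.inc e w)]
  have h₁ : ∀ e ∈ (Finset.univ.erase a).erase b,
      (Function.update z b 0) e * (N.merge a b x y).inc e w = z e * N.inc e w := by
    intro e he
    simp only [Finset.mem_erase, Finset.mem_univ, and_true] at he
    rw [Function.update_of_ne he.1, inc, inc, merge_src, merge_tgt,
      Function.update_of_ne he.2, Function.update_of_ne he.2]
  rw [Finset.sum_congr rfl h₁, Function.update_self, Function.update_of_ne hab, ha.inc_eq,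
    hb.inc_eq, ← hz, inc, merge_src, merge_tgt]
  simp only [Function.update_self, zero_mul, zero_add]
  have h₂ : (if v = w then (1 : ZMod 2) else 0) + (if v = w then 1 else 0) = 0 :=
    CharTwo.add_self_eq_zero _
  linear_combination (-z a) * h₂

theorem eq_of_star_eq_pair (hab : a ≠ b) (ha : N.Joins a v x) (hb : N.Joins b v y)
    (hvx : v ≠ x) (hvy : v ≠ y) (hv : N.star v = {a, b}) {z : E → ZMod 2}
    (hz : z ∈ N.cycleSpace) : z a = z b := by
  have h := hz.2 v
  rw [vertex_sum_eq hz.1, hv, Finset.sum_pair hab, ha.inc_eq, hb.inc_eq] at h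
  simp only [if_true, if_neg hvx.symm, if_neg hvy.symm, add_zero, mul_one] at h
  exact CharTwo.add_eq_zero.1 h

theorem mem_cycleSpace_merge (hab : a ≠ b) (ha : N.Joins a v x) (hb : N.Joins b v y)
    (hbe : b ∈ N.edges) {z : E → ZMod 2} (hz : z a = z b) :
    Function.update z b 0 ∈ (N.merge a b x y).cycleSpace ↔ z ∈ N.cycleSpace := by
  rw [mem_cycleSpace, mem_cycleSpace]
  simp only [vertex_sum_merge hab ha hb hz]
  refine and_congr_left fun _ ↦ ⟨fun h e he ↦ ?_, fun h e he ↦ ?_⟩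
  · have := h e fun h' ↦ he (Finset.mem_of_mem_erase h')
    rwa [Function.update_of_ne (ne_of_mem_of_not_mem hbe he).symm] at this
  · by_cases heb : e = b
    · rw [heb, Function.update_self]
    · rw [Function.update_of_ne heb]
      exact h e fun h' ↦ he (Finset.mem_erase.2 ⟨heb, h'⟩)

/-- Cycle-space vectors agree on a and b. Setting coordinate b to 0 is therefore an isomorphism of
cycle spaces, with inverse copying coordinate a to b; it preserves minimality of supports and, as
the merged link has the total length, the length. -/
theorem Admissible.merge {t : ℕ} (hN : N.Admissible t) (hab : a ≠ b) (ha : N.Joins a v x)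
    (hb : N.Joins b v y) (hvx : v ≠ x) (hvy : v ≠ y) (hv : N.star v = {a, b}) :
    (N.merge a b x y).Admissible t := by
  have hae : a ∈ N.edges := (mem_star.1 (show a ∈ N.star v by simp [hv])).1
  have hbe : b ∈ N.edges := (mem_star.1 (show b ∈ N.star v by simp [hv])).1
  have heq := fun {z} ↦ eq_of_star_eq_pair (z := z) hab ha hb hvx hvy hv
  have hmem := fun {z} ↦ mem_cycleSpace_merge (z := z) hab ha hb hbe
  have hlift : ∀ z ∈ (N.merge a b x y).cycleSpace,
      Function.update (Function.update z b (z a)) b 0 = z := by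
    intro z hz
    rw [Function.update_idem, Function.update_eq_self_iff]
    exact (hz.1 b (Finset.notMem_erase _ _)).symm
  have hlift' : ∀ z ∈ (N.merge a b x y).cycleSpace, Function.update z b (z a) ∈ N.cycleSpace := by
    intro z hz
    rw [← hmem (by rw [Function.update_self, Function.update_of_ne hab]), hlift z hz]
    exact hz
  refine ⟨fun e he ↦ ?_, fun e he ↦ ?_, fun e he ↦ ?_, ?_, fun z hz ↦ ?_⟩
  · have he := Finset.mem_of_mem_erase he
    rw [merge_len]
    by_cases h : e = a
    · rw [h, Function.update_self]
      have := hN.one_le_len _ hae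
      omega
    · rw [Function.update_of_ne h]
      exact hN.one_le_len _ he
  · have he := Finset.mem_of_mem_erase he
    rw [merge_step]
    by_cases h : e = a
    · rw [h, Function.update_self]
      exact max_le (hN.step_le _ hae) (hN.step_le _ hbe)
    · rw [Function.update_of_ne h]
      exact hN.step_le _ he
  · have he := Finset.mem_of_mem_erase he
    simp only [merge_len, merge_step]
    by_cases h : e = a
    · rw [h, Function.update_self, Function.update_self]
      have := hN.step_le_len _ hae
      have := hN.step_le_len _ hbe
      omega
    · rw [Function.update_of_ne h, Function.update_of_ne h]
      exact hN.step_le_len _ he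
  · obtain ⟨F, hF, hcov⟩ := hN.flat
    let T : (E → ZMod 2) →ₗ[ZMod 2] (E → ZMod 2) :=
      { toFun := fun z ↦ Function.update z b 0
        map_add' := fun y z ↦ by rw [← Function.update_add, add_zero]
        map_smul' := fun c z ↦ by
          rw [RingHom.id_apply, ← Function.update_smul, smul_zero] }
    refine ⟨F.image T, ?_, fun f ↦ ?_⟩
    · rw [Finset.coe_image, ← Submodule.map_span, hF]
      ext z
      rw [Submodule.mem_map]
      constructor
      · rintro ⟨y, hy, rfl⟩
        exact (hmem (heq hy)).2 hy
      · intro hz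
        exact ⟨_, hlift' z hz, hlift z hz⟩
    · rw [Finset.filter_image]
      refine Finset.card_image_le.trans ((Finset.card_le_card fun C hC ↦ ?_).trans (hcov f))
      rw [Finset.mem_filter] at hC ⊢
      refine ⟨hC.1, fun h ↦ hC.2 ?_⟩
      change Function.update C b 0 f = 0
      by_cases hfb : f = b
      · rw [hfb, Function.update_self]
      · rw [Function.update_of_ne hfb, h]
  · obtain ⟨hz, hz₀, hmin⟩ := hz
    have hza : Function.update z b (z a) a = z a := Function.update_of_ne hab _ _
    have hc : N.IsCycle (Function.update z b (z a)) := by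
      refine ⟨hlift' z hz, fun h ↦ hz₀ ?_, fun y hy hy₀ hs ↦ ?_⟩
      · rw [← hlift z hz, h, Function.update_eq_self_iff, Pi.zero_apply]
      · have h₁ : Function.update y b 0 = z := by
          refine hmin _ ((hmem (heq hy)).2 hy) (fun h ↦ hy₀ ?_) fun e he ↦ ?_
          · funext e
            have h' : ∀ f, f ≠ b → y f = 0 := fun f hf ↦ by
              have := congrFun h f
              rwa [Function.update_of_ne hf] at this
            by_cases heb : e = b
            · rw [heb, ← heq hy, h' a hab, Pi.zero_apply]
            · exact h' e heb
          · rw [mem_vecSupp] at he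
            by_cases heb : e = b
            · rw [heb, Function.update_self] at he
              exact absurd rfl he
            · rw [Function.update_of_ne heb, ← mem_vecSupp] at he
              have := hs he
              rwa [mem_vecSupp, Function.update_of_ne heb, ← mem_vecSupp] at this
        rw [← h₁, Function.update_idem, Function.update_of_ne hab, heq hy,
          Function.update_eq_self]
    have hl : (N.merge a b x y).length z = N.length (Function.update z b (z a)) := by
      rw [length_eq_sum, length_eq_sum, sum_eq_add_add_sum_erase hab,
        sum_eq_add_add_sum_erase hab
          (fun e ↦ if Function.update z b (z a) e ≠ 0 then N.len e else 0)]
      have h₁ : ∀ e ∈ (Finset.univ.erase a).erase b,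
          (if z e ≠ 0 then (N.merge a b x y).len e else 0) =
            if Function.update z b (z a) e ≠ 0 then N.len e else 0 := by
        intro e he
        simp only [Finset.mem_erase, Finset.mem_univ, and_true] at he
        rw [Function.update_of_ne he.1, merge_len, Function.update_of_ne he.2]
      have hzb : z b = 0 := hz.1 b (Finset.notMem_erase _ _)
      rw [Finset.sum_congr rfl h₁, hza, Function.update_self, if_neg (not_not.2 hzb),
        merge_len, Function.update_self]
      split_ifs <;> omega
    rw [hl]
    exact hN.length_cycle _ hc

end Merge

theorem colorable_of_star_eq_pair {N : LinkGraph V E} {t : ℕ} (hN : N.Admissible t)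
    (ih : ∀ M : LinkGraph V E, M.edges.card < N.edges.card → M.Admissible t → M.Colorable t)
    (hlen : ∀ e ∈ N.edges, N.len e < 2 * t) {v : V} {a b : E} (hab : a ≠ b)
    (hv : N.star v = {a, b}) : N.Colorable t := by
  have hav : a ∈ N.star v := by simp [hv]
  have hbv : b ∈ N.star v := by simp [hv]
  have hae := (mem_star.1 hav).1
  have hbe := (mem_star.1 hbv).1
  obtain ⟨x, ha⟩ := exists_joins_of_mem_star hav
  obtain ⟨y, hb⟩ := exists_joins_of_mem_star hbv
  have hvx := hN.joins_ne hlen hae ha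
  have hvy := hN.joins_ne hlen hbe hb
  obtain ⟨φ, hφ, h⟩ := ih (N.merge a b x y) (Finset.card_erase_lt_of_mem hbe)
    (hN.merge hab ha hb hvx hvy hv)
  have h₁ := h a (Finset.mem_erase.2 ⟨hab, hae⟩)
  simp only [merge_src, merge_tgt, merge_len, merge_step, Function.update_self] at h₁
  obtain ⟨W, hW, hWa, hWb⟩ := h₁.exists_between (hφ x) (hφ y) (hlen a hae) (hlen b hbe)
    (hN.step_le _ hae) (hN.step_le _ hbe) (hN.step_le_len _ hae) (hN.step_le_len _ hbe)
  refine ⟨Function.update φ v W, fun w ↦ ?_, fun f hf ↦ ?_⟩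
  · by_cases hw : w = v
    · rw [hw, Function.update_self, hW]
    · rw [Function.update_of_ne hw, hφ]
  · by_cases hfa : f = a
    · subst hfa
      rw [ha.symm.inter_card, Function.update_self, Function.update_of_ne hvx.symm]
      exact hWa
    by_cases hfb : f = b
    · subst hfb
      rw [hb.inter_card, Function.update_self, Function.update_of_ne hvy.symm]
      exact hWb
    · have hfv : f ∉ N.star v := by simp [hv, hfa, hfb]
      rw [mem_star] at hfv
      push Not at hfv
      rw [Function.update_of_ne (hfv hf).1, Function.update_of_ne (hfv hf).2]
      have := h f (Finset.mem_erase.2 ⟨hfb, hf⟩)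
      simpa only [merge_src, merge_tgt, merge_len, merge_step, Function.update_of_ne hfa] using this

/-- The two edges form a cycle of length below 4t, which excludes the long alternative. -/
theorem Admissible.len_add_len_of_parallel {N : LinkGraph V E} {t : ℕ} (hN : N.Admissible t)
    (hlen : ∀ e ∈ N.edges, N.len e < 2 * t) {u v : V} {a b : E} (hab : a ≠ b)
    (hae : a ∈ N.edges) (hbe : b ∈ N.edges) (ha : N.Joins a u v) (hb : N.Joins b u v) :
    N.len a + N.len b = 2 * t + 1 := by
  have huv := hN.joins_ne hlen hae ha
  set c : E → ZMod 2 := Pi.single a 1 + Pi.single b 1 with hc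
  have hca : c a = 1 := by simp [hc, hab]
  have hcb : c b = 1 := by simp [hc, hab.symm]
  have hc₀ : ∀ e, e ≠ a → e ≠ b → c e = 0 := fun e h₁ h₂ ↦ by simp [hc, h₁, h₂]
  have hcyc : N.IsCycle c := by
    refine ⟨⟨fun e he ↦ hc₀ e (ne_of_mem_of_not_mem hae he).symm (ne_of_mem_of_not_mem hbe he).symm,
      fun w ↦ ?_⟩,
      fun h ↦ ?_, fun y hy hy₀ hs ↦ ?_⟩
    · rw [sum_eq_add_add_sum_erase hab, Finset.sum_eq_zero, hca, hcb, ha.inc_eq, hb.inc_eq,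
        add_zero, CharTwo.add_self_eq_zero]
      intro e he
      simp only [Finset.mem_erase, Finset.mem_univ, and_true] at he
      rw [hc₀ e he.2 he.1, zero_mul]
    · rw [h] at hca
      exact zero_ne_one hca
    · have hy' : ∀ e, e ≠ a → e ≠ b → y e = 0 := by
        intro e h₁ h₂
        by_contra h
        exact mem_vecSupp.1 (hs (mem_vecSupp.2 h)) (hc₀ e h₁ h₂)
      have h := hy.2 u
      rw [sum_eq_add_add_sum_erase hab, Finset.sum_eq_zero, ha.inc_eq, hb.inc_eq] at h
      · simp only [if_true, if_neg huv.symm, add_zero, mul_one] at h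
        have h := CharTwo.add_eq_zero.1 h
        have hya : y a ≠ 0 := by
          intro h₀
          refine hy₀ (funext fun e ↦ ?_)
          by_cases h₁ : e = a
          · rw [h₁, h₀, Pi.zero_apply]
          by_cases h₂ : e = b
          · rw [h₂, ← h, h₀, Pi.zero_apply]
          · exact hy' e h₁ h₂
        funext e
        by_cases h₁ : e = a
        · rw [h₁, hca, ZMod.two_eq_one_of_ne_zero hya]
        by_cases h₂ : e = b
        · rw [h₂, hcb, ← h, ZMod.two_eq_one_of_ne_zero hya]
        · rw [hc₀ e h₁ h₂, hy' e h₁ h₂]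
      · intro e he
        simp only [Finset.mem_erase, Finset.mem_univ, and_true] at he
        rw [hy' e he.2 he.1, zero_mul]
  have hl : N.length c = N.len a + N.len b := by
    rw [length_eq_sum, sum_eq_add_add_sum_erase hab, Finset.sum_eq_zero, hca, hcb]
    · simp
    · intro e he
      simp only [Finset.mem_erase, Finset.mem_univ, and_true] at he
      rw [hc₀ e he.2 he.1, if_neg (by simp)]
  have := hN.length_cycle c hcyc
  have := hlen a hae
  have := hlen b hbe
  omega

theorem colorable_of_parallel {N : LinkGraph V E} {t : ℕ} (hN : N.Admissible t)
    (ih : ∀ M : LinkGraph V E, M.edges.card < N.edges.card → M.Admissible t → M.Colorable t)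
    (hlen : ∀ e ∈ N.edges, N.len e < 2 * t) {u v : V} {a b : E} (hab : a ≠ b)
    (hae : a ∈ N.edges) (hbe : b ∈ N.edges) (ha : N.Joins a u v) (hb : N.Joins b u v) :
    N.Colorable t := by
  wlog hle : N.len a ≤ N.len b generalizing a b
  · exact this hab.symm hbe hae hb ha (by omega)
  have hsum := hN.len_add_len_of_parallel hlen hab hae hbe ha hb
  have hR := hN.restrict (Finset.erase_subset b N.edges)
  -- Rigidity of the shorter edge encodes the deleted one. Since the lengths add up to 2t+1, the
  -- shorter is at most t, as a step must be.
  let M : LinkGraph V E :=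
    { N.restrict (N.edges.erase b) with step := Function.update N.step a (N.len a) }
  have hM : M.Admissible t := by
    refine ⟨hR.one_le_len, fun e he ↦ ?_, fun e he ↦ ?_, hR.flat, hR.length_cycle⟩
    · by_cases h : e = a
      · simp only [M, h, Function.update_self]
        omega
      · simp only [M, Function.update_of_ne h]
        exact hR.step_le e he
    · by_cases h : e = a
      · simp only [M, h, Function.update_self, restrict_len, le_refl]
      · simp only [M, Function.update_of_ne h]
        exact hR.step_le_len e he
  obtain ⟨φ, hφ, h⟩ := ih M (Finset.card_erase_lt_of_mem hbe) hM
  have h₁ := h a (Finset.mem_erase.2 ⟨hab, hae⟩)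
  simp only [M, restrict_len, restrict_src, restrict_tgt, Function.update_self] at h₁
  have h₂ := h₁.of_rigid hsum (hN.step_le_len a hae) (hN.step_le_len b hbe)
  refine ⟨φ, hφ, fun f hf ↦ ?_⟩
  by_cases hfa : f = a
  · subst hfa
    exact h₂.1
  by_cases hfb : f = b
  · subst hfb
    rw [hb.inter_card, ← ha.inter_card]
    exact h₂.2
  · have := h f (Finset.mem_erase.2 ⟨hfb, hf⟩)
    simpa only [M, Function.update_of_ne hfa, restrict_len, restrict_src, restrict_tgt] using this

/-- The triangle and its exits are deleted; the outer ends of the exits keep their colours while the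
corners are recoloured. -/
theorem colorable_of_triangle {N : LinkGraph V E} {t : ℕ} (hN : N.Admissible t)
    (ih : ∀ M : LinkGraph V E, M.edges.card < N.edges.card → M.Admissible t → M.Colorable t)
    {x y z x' y' z' : V} {p q r a b c : E}
    (hxy : x ≠ y) (hyz : y ≠ z) (hzx : z ≠ x)
    (hp : N.Joins p x y) (hq : N.Joins q y z) (hr : N.Joins r z x)
    (ha : N.Joins a x x') (hb : N.Joins b y y') (hc : N.Joins c z z')
    (hx : N.star x = {p, r, a}) (hy : N.star y = {p, q, b}) (hz : N.star z = {q, r, c})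
    (hx' : x' ≠ x ∧ x' ≠ y ∧ x' ≠ z) (hy' : y' ≠ x ∧ y' ≠ y ∧ y' ≠ z)
    (hz' : z' ≠ x ∧ z' ≠ y ∧ z' ≠ z) (hsum : N.len p + N.len q + N.len r = 2 * t + 1)
    (hla : t + 6 ≤ N.len a) (hlb : t + 6 ≤ N.len b) (hlc : t + 6 ≤ N.len c) :
    N.Colorable t := by
  have hpe : p ∈ N.edges := (mem_star.1 (show p ∈ N.star x by simp [hx])).1
  have hqe : q ∈ N.edges := (mem_star.1 (show q ∈ N.star y by simp [hy])).1
  have hre : r ∈ N.edges := (mem_star.1 (show r ∈ N.star x by simp [hx])).1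
  have hae : a ∈ N.edges := (mem_star.1 (show a ∈ N.star x by simp [hx])).1
  have hbe : b ∈ N.edges := (mem_star.1 (show b ∈ N.star y by simp [hy])).1
  have hce : c ∈ N.edges := (mem_star.1 (show c ∈ N.star z by simp [hz])).1
  have hsub : N.edges \ {p, q, r, a, b, c} ⊆ N.edges := Finset.sdiff_subset
  obtain ⟨φ, hφ, h⟩ := ih (N.restrict (N.edges \ {p, q, r, a, b, c}))
    (Finset.card_lt_card (Finset.sdiff_ssubset (by
      simp [Finset.insert_subset_iff, hpe, hqe, hre, hae, hbe, hce]) (by simp)))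
    (hN.restrict hsub)
  obtain ⟨X, Y, Z, hX, hY, hZ, lp, lq, lr, la, lb, lc⟩ :=
    LinkRel.exists_triangle hsum (hφ x') (hφ y') (hφ z') (hN.step_le_len p hpe)
      (hN.step_le_len q hqe) (hN.step_le_len r hre) hla hlb hlc (hN.step_le a hae)
      (hN.step_le b hbe) (hN.step_le c hce)
  let ψ : V → Finset (Fin (2 * t + 1)) :=
    Function.update (Function.update (Function.update φ x X) y Y) z Z
  have hψx : ψ x = X := by simp [ψ, hzx.symm, hxy]
  have hψy : ψ y = Y := by simp [ψ, hyz]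
  have hψz : ψ z = Z := by simp [ψ]
  have hψ : ∀ w, w ≠ x → w ≠ y → w ≠ z → ψ w = φ w := fun w h₁ h₂ h₃ ↦ by
    simp [ψ, h₁, h₂, h₃]
  refine ⟨ψ, fun w ↦ ?_, fun f hf ↦ ?_⟩
  · by_cases h₁ : w = x
    · rw [h₁, hψx, hX]
    by_cases h₂ : w = y
    · rw [h₂, hψy, hY]
    by_cases h₃ : w = z
    · rw [h₃, hψz, hZ]
    · rw [hψ w h₁ h₂ h₃, hφ]
  · by_cases hmem : f ∈ ({p, q, r, a, b, c} : Finset E)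
    · simp only [Finset.mem_insert, Finset.mem_singleton] at hmem
      rcases hmem with rfl | rfl | rfl | rfl | rfl | rfl
      · rwa [hp.inter_card, hψx, hψy]
      · rwa [hq.inter_card, hψy, hψz]
      · rwa [hr.inter_card, hψz, hψx]
      · rwa [ha.inter_card, hψx, hψ _ hx'.1 hx'.2.1 hx'.2.2]
      · rwa [hb.inter_card, hψy, hψ _ hy'.1 hy'.2.1 hy'.2.2]
      · rwa [hc.inter_card, hψz, hψ _ hz'.1 hz'.2.1 hz'.2.2]
    · have hfx : f ∉ N.star x := fun h ↦ hmem (by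
        rw [hx] at h; simp only [Finset.mem_insert, Finset.mem_singleton] at h ⊢; tauto)
      have hfy : f ∉ N.star y := fun h ↦ hmem (by
        rw [hy] at h; simp only [Finset.mem_insert, Finset.mem_singleton] at h ⊢; tauto)
      have hfz : f ∉ N.star z := fun h ↦ hmem (by
        rw [hz] at h; simp only [Finset.mem_insert, Finset.mem_singleton] at h ⊢; tauto)
      rw [mem_star] at hfx hfy hfz
      push Not at hfx hfy hfz
      rw [hψ _ (hfx hf).1 (hfy hf).1 (hfz hf).1, hψ _ (hfx hf).2 (hfy hf).2 (hfz hf).2]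
      exact h f (Finset.mem_sdiff.2 ⟨hf, hmem⟩)

end LinkGraph

/-! ### Irreducible link graphs: Euler's inequality and short cycles. -/

namespace LinkGraph

variable {V E : Type*} [Fintype E] [DecidableEq V] [DecidableEq E]

/-- An admissible link graph to which no reduction at a single vertex or at two parallel edges
applies. -/
structure Reduced (N : LinkGraph V E) (t : ℕ) : Prop where
  admissible : N.Admissible t
  len_lt : ∀ e ∈ N.edges, N.len e < 2 * t
  eq_of_joins : ∀ a ∈ N.edges, ∀ b ∈ N.edges, ∀ u v, N.Joins a u v → N.Joins b u v → a = b
  three_le_card_star : ∀ v, (N.star v).Nonempty → 3 ≤ (N.star v).card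

/-- Euler's inequality by rank and nullity of the boundary map: its kernel lies in the span of F,
and its image lies in the proper subspace of vectors with coordinate sum zero. -/
theorem card_edges_add_one_le [Fintype V] {N : LinkGraph V E} {F : Finset (E → ZMod 2)}
    (hF : Submodule.span (ZMod 2) (F : Set (E → ZMod 2)) = N.cycleSpace)
    (hne : N.edges.Nonempty) :
    N.edges.card + 1 ≤ F.card + (Finset.univ.filter fun v ↦ (N.star v).Nonempty).card := by
  set T := Finset.univ.filter fun v ↦ (N.star v).Nonempty with hT
  let bd : (N.edges → ZMod 2) →ₗ[ZMod 2] (T → ZMod 2) :=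
    { toFun := fun z v ↦ ∑ e, z e * N.inc e v
      map_add' := fun y z ↦ by
        funext v; simp [add_mul, Finset.sum_add_distrib]
      map_smul' := fun c z ↦ by
        funext v; simp [mul_assoc, Finset.mul_sum] }
  let ext : (N.edges → ZMod 2) →ₗ[ZMod 2] (E → ZMod 2) :=
    { toFun := fun z e ↦ if h : e ∈ N.edges then z ⟨e, h⟩ else 0
      map_add' := fun y z ↦ by
        funext e; by_cases h : e ∈ N.edges <;> simp [h]
      map_smul' := fun c z ↦ by
        funext e; by_cases h : e ∈ N.edges <;> simp [h] }
  have hext : Function.Injective ext := by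
    intro y z h
    funext e
    have := congrFun h e.1
    simpa [ext, e.2] using this
  have hsum : ∀ z : N.edges → ZMod 2, ∀ v, ∑ e, ext z e * N.inc e v = ∑ e, z e * N.inc e v := by
    intro z v
    rw [← Finset.sum_subset (Finset.subset_univ N.edges), ← Finset.sum_coe_sort]
    · refine Finset.sum_congr rfl fun e _ ↦ ?_
      simp [ext, e.2]
    · intro e _ he
      simp [ext, he]
  have hker : Submodule.map ext (LinearMap.ker bd) ≤ N.cycleSpace := by
    rintro _ ⟨z, hz, rfl⟩
    refine ⟨fun e he ↦ by simp [ext, he], fun v ↦ ?_⟩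
    rw [hsum]
    by_cases hv : v ∈ T
    · exact congrFun hz ⟨v, hv⟩
    · refine Finset.sum_eq_zero fun e _ ↦ ?_
      rw [inc_eq_zero e.2, mul_zero]
      intro he
      exact hv (Finset.mem_filter.2 ⟨Finset.mem_univ _, ⟨_, he⟩⟩)
  have h₁ : Module.finrank (ZMod 2) (LinearMap.ker bd) ≤ F.card := by
    rw [LinearEquiv.finrank_eq (Submodule.equivMapOfInjective ext hext (LinearMap.ker bd))]
    refine (Submodule.finrank_mono hker).trans ?_
    rw [← hF]
    exact finrank_span_finset_le_card F
  have hends : ∀ e ∈ N.edges, N.src e ∈ T ∧ N.tgt e ∈ T := by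
    intro e he
    constructor
    · exact Finset.mem_filter.2 ⟨Finset.mem_univ _, e, (N.joins_src_tgt e).mem_star he⟩
    · exact Finset.mem_filter.2 ⟨Finset.mem_univ _, e, (N.joins_src_tgt e).symm.mem_star he⟩
  let tot : (T → ZMod 2) →ₗ[ZMod 2] ZMod 2 := ∑ v, LinearMap.proj v
  have htot : ∀ f, tot f = ∑ v, f v := fun f ↦ by simp [tot]
  have hrange : LinearMap.range bd ≤ LinearMap.ker tot := by
    rintro _ ⟨z, rfl⟩
    rw [LinearMap.mem_ker, htot]
    change ∑ v : T, ∑ e, z e * N.inc e v = 0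
    rw [Finset.sum_comm]
    refine Finset.sum_eq_zero fun e _ ↦ ?_
    rw [← Finset.mul_sum, Finset.sum_coe_sort T (fun v ↦ N.inc e v)]
    simp only [inc, Finset.sum_add_distrib, Finset.sum_ite_eq, (hends e e.2).1, (hends e e.2).2,
      if_true]
    rw [CharTwo.add_self_eq_zero, mul_zero]
  have h₂ : Module.finrank (ZMod 2) (LinearMap.range bd) < T.card := by
    have : Module.finrank (ZMod 2) (T → ZMod 2) = T.card := by
      rw [Module.finrank_fintype_fun_eq_card, Fintype.card_coe]
    rw [← this]
    refine Submodule.finrank_lt (fun h ↦ ?_)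
    rw [h, top_le_iff, LinearMap.ker_eq_top] at hrange
    obtain ⟨e, he⟩ := hne
    have h' := LinearMap.congr_fun hrange (Pi.single ⟨_, (hends e he).1⟩ 1)
    rw [htot, Finset.sum_pi_single'] at h'
    simp at h'
  have h₃ := LinearMap.finrank_range_add_finrank_ker bd
  rw [Module.finrank_fintype_fun_eq_card, Fintype.card_coe] at h₃
  omega

/-- Two distinct cycles of the minimal length have no common edge. -/
theorem Admissible.disjoint_cycles {N : LinkGraph V E} {t : ℕ} (hN : N.Admissible t)
    {y z : E → ZMod 2} (hy : y ∈ N.cycleSpace) (hz : z ∈ N.cycleSpace)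
    (hyl : N.length y = 2 * t + 1)
    (hzl : N.length z = 2 * t + 1) (hne : y ≠ z) : Disjoint (vecSupp y) (vecSupp z) := by
  rw [Finset.disjoint_left]
  intro e hey hez
  have hmem := N.cycleSpace.add_mem hy hz
  have h₀ : y + z ≠ 0 := fun h ↦ hne (by
    have := congrArg (· + z) h
    simpa [add_assoc, add_self_eq_zero_of_zmod_two] using this)
  -- The sum has even length, less than twice 2t+1.
  have hl : N.length (y + z) + 2 * ∑ f ∈ vecSupp y ∩ vecSupp z, N.len f = 2 * (2 * t + 1) := by
    have h₁ := Finset.sum_inter_add_sum_sdiff (vecSupp y) (vecSupp z) N.len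
    have h₂ := Finset.sum_inter_add_sum_sdiff (vecSupp z) (vecSupp y) N.len
    have h₃ : N.length (y + z) = ∑ f ∈ vecSupp y \ vecSupp z, N.len f +
        ∑ f ∈ vecSupp z \ vecSupp y, N.len f := by
      rw [length, vecSupp_add, symmDiff_def, Finset.sup_eq_union,
        Finset.sum_union disjoint_sdiff_sdiff]
    rw [Finset.inter_comm] at h₂
    unfold length at hyl hzl
    omega
  have hpos : 1 ≤ ∑ f ∈ vecSupp y ∩ vecSupp z, N.len f := by
    refine (hN.one_le_len e ?_).trans
      (Finset.single_le_sum (f := N.len) (fun _ _ ↦ Nat.zero_le _) (Finset.mem_inter.2 ⟨hey, hez⟩))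
    by_contra he
    exact mem_vecSupp.1 hey (hy.1 e he)
  obtain ⟨x, hx, hs⟩ := exists_isCycle_subset hmem h₀
  have hsplit := N.length_add_of_subset hs
  have hxl := hN.le_length hx.1 hx.2.1
  -- Two disjoint nonzero parts would have total length at least 2(2t+1), so the sum is itself a
  -- cycle. Its even length is not 2t+1, and it is too short for the other alternative.
  have h₁ : y + z + x = 0 := by
    by_contra h
    have := hN.le_length (N.cycleSpace.add_mem hmem hx.1) h
    omega
  have h₂ : N.length (0 : E → ZMod 2) = 0 := by simp [length_eq_sum]
  rw [h₁, h₂] at hsplit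
  have := hN.length_cycle x hx
  omega

section Reduced

variable {N : LinkGraph V E} {t : ℕ}

theorem mem_edges_of_mem_vecSupp {z : E → ZMod 2} (hz : z ∈ N.cycleSpace) {e : E}
    (he : e ∈ vecSupp z) : e ∈ N.edges := by
  by_contra h
  exact mem_vecSupp.1 he (hz.1 e h)

theorem Admissible.even_card_inter_star (hN : N.Admissible t)
    (hlen : ∀ e ∈ N.edges, N.len e < 2 * t) {z : E → ZMod 2} (hz : z ∈ N.cycleSpace) (v : V) :
    Even (vecSupp z ∩ N.star v).card := by
  have h := hz.2 v
  rw [vertex_sum_eq hz.1] at h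
  have h₁ : ∀ e ∈ N.star v, z e * N.inc e v = if e ∈ vecSupp z then 1 else 0 := by
    intro e he
    obtain ⟨u, hu⟩ := exists_joins_of_mem_star he
    have hvu := hN.joins_ne hlen (mem_star.1 he).1 hu
    rw [hu.inc_eq, if_pos rfl, if_neg hvu.symm, add_zero, mul_one]
    split_ifs with hez
    · exact ZMod.two_eq_one_of_ne_zero (mem_vecSupp.1 hez)
    · exact not_not.1 (mt mem_vecSupp.2 hez)
  rw [Finset.sum_congr rfl h₁, Finset.sum_boole, Finset.filter_mem_eq_inter,
    Finset.inter_comm] at h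
  exact (ZMod.natCast_eq_zero_iff_even).1 h

theorem Admissible.two_le_card_inter_star (hN : N.Admissible t)
    (hlen : ∀ e ∈ N.edges, N.len e < 2 * t) {z : E → ZMod 2} (hz : z ∈ N.cycleSpace) {v : V}
    (hv : (vecSupp z ∩ N.star v).Nonempty) : 2 ≤ (vecSupp z ∩ N.star v).card := by
  obtain ⟨k, hk⟩ := hN.even_card_inter_star hlen hz v
  have := Finset.card_pos.2 hv
  omega

theorem Reduced.sum_outer_le (hN : N.Reduced t) (v : V) (I : Finset E) :
    ∑ e ∈ N.star v \ I, N.len e ≤ (N.star v \ I).card * (2 * t + 1) := by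
  rw [← smul_eq_mul]
  refine Finset.sum_le_card_nsmul _ _ _ fun e he ↦ ?_
  have := hN.len_lt e (mem_star.1 (Finset.mem_sdiff.1 he).1).1
  omega

/-- The handshake lemma. -/
theorem Admissible.sum_star [Fintype V] (hN : N.Admissible t)
    (hlen : ∀ e ∈ N.edges, N.len e < 2 * t) {A : Finset E} (hA : A ⊆ N.edges) (g : E → ℕ) :
    ∑ v, ∑ e ∈ N.star v ∩ A, g e = 2 * ∑ e ∈ A, g e := by
  have h₁ : ∀ v, N.star v ∩ A = A.filter fun e ↦ N.src e = v ∨ N.tgt e = v := by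
    intro v
    ext e
    rw [Finset.mem_inter, mem_star, Finset.mem_filter]
    exact ⟨fun h ↦ ⟨h.2, h.1.2⟩, fun h ↦ ⟨⟨hA h.1, h.2⟩, h.1⟩⟩
  simp only [h₁, Finset.sum_filter]
  rw [Finset.sum_comm, Finset.mul_sum]
  refine Finset.sum_congr rfl fun e he ↦ ?_
  rw [← Finset.sum_filter, Finset.sum_const, smul_eq_mul]
  congr 1
  have h₂ : (Finset.univ.filter fun v ↦ N.src e = v ∨ N.tgt e = v) = {N.src e, N.tgt e} := by
    ext v; simp [eq_comm]
  rw [h₂, Finset.card_pair (hN.src_ne_tgt hlen (hA he))]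

/-- The vertices of the support of a vector. -/
def vertexSupp [Fintype V] (N : LinkGraph V E) (z : E → ZMod 2) : Finset V :=
  Finset.univ.filter fun v ↦ (vecSupp z ∩ N.star v).Nonempty

theorem mem_vertexSupp [Fintype V] {z : E → ZMod 2} {v : V} :
    v ∈ N.vertexSupp z ↔ (vecSupp z ∩ N.star v).Nonempty := by simp [vertexSupp]

theorem Joins.mem_vertexSupp [Fintype V] {z : E → ZMod 2} {e : E} {u v : V} (h : N.Joins e u v)
    (hz : z ∈ N.cycleSpace) (he : e ∈ vecSupp z) : u ∈ N.vertexSupp z :=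
  LinkGraph.mem_vertexSupp.2
    ⟨e, Finset.mem_inter.2 ⟨he, h.mem_star (mem_edges_of_mem_vecSupp hz he)⟩⟩

/-- There are neither loops nor parallel edges. -/
theorem Reduced.three_le_card_vertexSupp [Fintype V] (hN : N.Reduced t) {z : E → ZMod 2}
    (hz : z ∈ N.cycleSpace) (hz₀ : z ≠ 0) : 3 ≤ (N.vertexSupp z).card := by
  obtain ⟨e, he⟩ := Finset.nonempty_iff_ne_empty.2 (mt vecSupp_eq_empty.1 hz₀)
  have hee := mem_edges_of_mem_vecSupp hz he
  have hj := N.joins_src_tgt e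
  have h₁ := hj.mem_vertexSupp hz he
  have h₂ := hj.symm.mem_vertexSupp hz he
  obtain ⟨f, hf, hfe⟩ := Finset.exists_mem_ne
    (hN.admissible.two_le_card_inter_star hN.len_lt hz (mem_vertexSupp.1 h₁)) e
  have hf := Finset.mem_inter.1 hf
  have hff := mem_edges_of_mem_vecSupp hz hf.1
  obtain ⟨u, hu⟩ := exists_joins_of_mem_star hf.2
  have h₃ := hu.symm.mem_vertexSupp hz hf.1
  have n₁ := hN.admissible.joins_ne hN.len_lt hee hj
  have n₂ := hN.admissible.joins_ne hN.len_lt hff hu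
  have n₃ : N.tgt e ≠ u := by
    rintro rfl
    exact hfe (hN.eq_of_joins f hff e hee _ _ hu hj)
  rw [← Finset.card_eq_three.2 ⟨_, _, _, n₁, n₂, n₃, rfl⟩]
  refine Finset.card_le_card ?_
  simp [Finset.insert_subset_iff, h₁, h₂, h₃]

end Reduced

end LinkGraph

/-! ### Discharging. -/

namespace LinkGraph

variable {V E : Type*} [Fintype E] [DecidableEq V] [DecidableEq E] [Fintype V]
  {N : LinkGraph V E} {t : ℕ}

/-- The three edges at a vertex of degree three on a cycle with three branch vertices. -/
theorem Reduced.exists_star_eq_triple (hN : N.Reduced t) {C : E → ZMod 2}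
    (hC : C ∈ N.cycleSpace) {x y z : V} (hv : N.vertexSupp C = {x, y, z})
    (hx : (N.star x).card = 3) : ∃ p r a x', p ∈ vecSupp C ∧ r ∈ vecSupp C ∧ a ∈ N.edges ∧
      N.Joins p x y ∧ N.Joins r x z ∧ N.Joins a x x' ∧ N.star x = {p, r, a} ∧
      x' ≠ x ∧ x' ≠ y ∧ x' ≠ z := by
  have hxv : x ∈ N.vertexSupp C := by simp [hv]
  have hother : ∀ e ∈ vecSupp C ∩ N.star x, N.Joins e x y ∨ N.Joins e x z := by
    intro e he
    have he := Finset.mem_inter.1 he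
    obtain ⟨u, hu⟩ := exists_joins_of_mem_star he.2
    have h₁ := hu.symm.mem_vertexSupp hC he.1
    have h₂ := hN.admissible.joins_ne hN.len_lt (mem_star.1 he.2).1 hu
    rw [hv, Finset.mem_insert, Finset.mem_insert, Finset.mem_singleton] at h₁
    rcases h₁ with rfl | rfl | rfl
    · exact absurd rfl h₂
    · exact Or.inl hu
    · exact Or.inr hu
  obtain ⟨p, r, hp, hr, hpy, hrz, hpr⟩ : ∃ p r, p ∈ vecSupp C ∩ N.star x ∧
      r ∈ vecSupp C ∩ N.star x ∧ N.Joins p x y ∧ N.Joins r x z ∧ p ≠ r := by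
    obtain ⟨e, he, f, hf, hef⟩ := Finset.one_lt_card.1
      (hN.admissible.two_le_card_inter_star hN.len_lt hC (mem_vertexSupp.1 hxv))
    have hee := (mem_star.1 (Finset.mem_inter.1 he).2).1
    have hff := (mem_star.1 (Finset.mem_inter.1 hf).2).1
    rcases hother e he with h₁ | h₁ <;> rcases hother f hf with h₂ | h₂
    · exact absurd (hN.eq_of_joins e hee f hff _ _ h₁ h₂) hef
    · exact ⟨e, f, he, hf, h₁, h₂, hef⟩
    · exact ⟨f, e, hf, he, h₂, h₁, hef.symm⟩
    · exact absurd (hN.eq_of_joins e hee f hff _ _ h₁ h₂) hef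
  rw [Finset.mem_inter] at hp hr
  obtain ⟨a, ha, hapr⟩ : ∃ a ∈ N.star x, a ∉ ({p, r} : Finset E) := by
    by_contra! h
    have := Finset.card_le_card (fun a ha ↦ h a ha : N.star x ⊆ {p, r})
    rw [hx, Finset.card_pair hpr] at this
    omega
  simp only [Finset.mem_insert, Finset.mem_singleton, not_or] at hapr
  obtain ⟨x', hx'⟩ := exists_joins_of_mem_star ha
  have hae := (mem_star.1 ha).1
  refine ⟨p, r, a, x', hp.1, hr.1, hae, hpy, hrz, hx', ?_,
    (hN.admissible.joins_ne hN.len_lt hae hx').symm, ?_, ?_⟩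
  · refine (Finset.eq_of_subset_of_card_le ?_ ?_).symm
    · simp [Finset.insert_subset_iff, hp.2, hr.2, ha]
    · rw [hx, Finset.card_eq_three.2 ⟨p, r, a, hpr, Ne.symm hapr.1, Ne.symm hapr.2, rfl⟩]
  · rintro rfl
    exact hapr.1 (hN.eq_of_joins a hae p (mem_star.1 hp.2).1 _ _ hx' hpy)
  · rintro rfl
    exact hapr.2 (hN.eq_of_joins a hae r (mem_star.1 hr.2).1 _ _ hx' hrz)

/-- The three exits have total length above 8(2t+1)/3 and each is shorter than 2t, which forces each
to be at least t+6. -/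
theorem Reduced.colorable_of_vertexSupp_eq_triple (hN : N.Reduced t)
    (ih : ∀ M : LinkGraph V E, M.edges.card < N.edges.card → M.Admissible t → M.Colorable t)
    {C : E → ZMod 2} (hC : C ∈ N.cycleSpace) (hlen : N.length C = 2 * t + 1) {x y z : V}
    (hxy : x ≠ y) (hxz : x ≠ z) (hyz : y ≠ z) (hv : N.vertexSupp C = {x, y, z})
    (hx : (N.star x).card = 3) (hy : (N.star y).card = 3) (hz : (N.star z).card = 3)
    {I : Finset E} (hI : vecSupp C ⊆ I)
    (hout : 8 * (2 * t + 1) < 3 * (∑ e ∈ N.star x \ I, N.len e + ∑ e ∈ N.star y \ I, N.len e +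
      ∑ e ∈ N.star z \ I, N.len e)) : N.Colorable t := by
  obtain ⟨p, r, a, x', hp, hr, hae, jp, jr, ja, sx, nx⟩ := hN.exists_star_eq_triple hC hv hx
  obtain ⟨q, p', b, y', hq, hp', hbe, jq, jp', jb, sy, ny⟩ :=
    hN.exists_star_eq_triple (x := y) (y := z) (z := x) hC (by
      rw [hv]; ext; simp only [Finset.mem_insert, Finset.mem_singleton]; tauto) hy
  obtain ⟨r', q', c, z', hr', hq', hce, jr', jq', jc, sz, nz⟩ :=
    hN.exists_star_eq_triple (x := z) (y := x) (z := y) hC (by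
      rw [hv]; ext; simp only [Finset.mem_insert, Finset.mem_singleton]; tauto) hz
  have hedge : ∀ {e}, e ∈ vecSupp C → e ∈ N.edges := fun he ↦ mem_edges_of_mem_vecSupp hC he
  obtain rfl : p = p' := hN.eq_of_joins _ (hedge hp) _ (hedge hp') _ _ jp jp'.symm
  obtain rfl : q = q' := hN.eq_of_joins _ (hedge hq) _ (hedge hq') _ _ jq jq'.symm
  obtain rfl : r = r' := hN.eq_of_joins _ (hedge hr) _ (hedge hr') _ _ jr jr'.symm
  have hpq : p ≠ q := by
    rintro rfl
    rcases jp with ⟨rfl, rfl⟩ | ⟨rfl, rfl⟩ <;> rcases jq with ⟨h₁, h₂⟩ | ⟨h₁, h₂⟩ <;>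
      first | exact hxy h₁ | exact hxz h₁ | exact hxz h₂ | exact hyz h₁
  have hpr : p ≠ r := by
    rintro rfl
    rcases jp with ⟨rfl, rfl⟩ | ⟨rfl, rfl⟩ <;> rcases jr with ⟨h₁, h₂⟩ | ⟨h₁, h₂⟩ <;>
      first | exact hyz h₁ | exact hyz h₂ | exact hxy h₁.symm | exact hxz h₁
  have hqr : q ≠ r := by
    rintro rfl
    rcases jq with ⟨rfl, rfl⟩ | ⟨rfl, rfl⟩ <;> rcases jr with ⟨h₁, h₂⟩ | ⟨h₁, h₂⟩ <;>
      first | exact hxy h₁.symm | exact hxy h₂.symm | exact hxz h₁.symm | exact hxz h₂.symm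
  have hsupp : vecSupp C = {p, q, r} := by
    refine Finset.Subset.antisymm (fun e he ↦ ?_) (by
      simp [Finset.insert_subset_iff, hp, hq, hr])
    have hj := N.joins_src_tgt e
    have h₁ := hj.mem_vertexSupp hC he
    have h₂ := hj.symm.mem_vertexSupp hC he
    have h₃ := hN.admissible.joins_ne hN.len_lt (hedge he) hj
    have key := fun f (hf : f ∈ vecSupp C) (u v : V) ↦
      hN.eq_of_joins e (hedge he) f (hedge hf) u v
    simp only [hv, Finset.mem_insert, Finset.mem_singleton] at h₁ h₂ ⊢
    rcases h₁ with h₁ | h₁ | h₁ <;> rcases h₂ with h₂ | h₂ | h₂ <;> rw [h₁, h₂] at hj h₃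
    · exact absurd rfl h₃
    · exact Or.inl (key p hp _ _ hj jp)
    · exact Or.inr (Or.inr (key r hr _ _ hj jr))
    · exact Or.inl (key p hp _ _ hj jp.symm)
    · exact absurd rfl h₃
    · exact Or.inr (Or.inl (key q hq _ _ hj jq))
    · exact Or.inr (Or.inr (key r hr _ _ hj jr.symm))
    · exact Or.inr (Or.inl (key q hq _ _ hj jq.symm))
    · exact absurd rfl h₃
  have hsum : N.len p + N.len q + N.len r = 2 * t + 1 := by
    rw [length, hsupp, Finset.sum_insert (by simp [hpq, hpr]), Finset.sum_pair hqr] at hlen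
    omega
  have hle : ∀ {v : V} {e f g : E}, N.star v = {e, f, g} → e ∈ vecSupp C → f ∈ vecSupp C →
      ∑ e ∈ N.star v \ I, N.len e ≤ N.len g := by
    intro v e f g hs he hf
    refine (Finset.sum_le_sum_of_subset (t := {g}) fun h hh ↦ ?_).trans
      (Finset.sum_singleton _ _).le
    rw [hs] at hh
    simp only [Finset.mem_sdiff, Finset.mem_insert, Finset.mem_singleton] at hh ⊢
    rcases hh.1 with rfl | rfl | h
    · exact absurd (hI he) hh.2
    · exact absurd (hI hf) hh.2
    · exact h
  have ha := hle sx hp hr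
  have hb := hle sy hq hp
  have hc := hle sz hr hq
  have := hN.len_lt a hae
  have := hN.len_lt b hbe
  have := hN.len_lt c hce
  refine colorable_of_triangle hN.admissible ih hxy hyz hxz.symm jp jq jr.symm ja jb jc sx ?_ ?_ nx
    ⟨ny.2.2, ny.1, ny.2.1⟩ ⟨nz.2.1, nz.2.2, nz.1⟩ hsum (by omega) (by omega) (by omega)
  · rw [sy, Finset.insert_comm]
  · rw [sz, Finset.insert_comm]

/-- A set of edge-disjoint cycles of minimal length. -/
structure IsShortCycles (N : LinkGraph V E) (t : ℕ) (K : Finset (E → ZMod 2)) : Prop where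
  mem_cycleSpace : ∀ C ∈ K, C ∈ N.cycleSpace
  length_eq : ∀ C ∈ K, N.length C = 2 * t + 1
  disjoint : (K : Set (E → ZMod 2)).PairwiseDisjoint vecSupp

variable {K : Finset (E → ZMod 2)}

/-- Each short cycle through v uses at least two edges there, and these cycles share no edge. -/
theorem Reduced.two_mul_card_add_card_le (hN : N.Reduced t) (hK : N.IsShortCycles t K) (v : V) :
    2 * (K.filter fun C ↦ v ∈ N.vertexSupp C).card + (N.star v \ K.biUnion vecSupp).card ≤
      (N.star v).card := by
  rw [← Finset.card_sdiff_add_card_inter (N.star v) (K.biUnion vecSupp), add_comm]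
  refine Nat.add_le_add_left ?_ _
  calc 2 * (K.filter fun C ↦ v ∈ N.vertexSupp C).card
      = ∑ C ∈ K.filter fun C ↦ v ∈ N.vertexSupp C, 2 := by
        rw [Finset.sum_const, smul_eq_mul, mul_comm]
    _ ≤ ∑ C ∈ K.filter fun C ↦ v ∈ N.vertexSupp C, (vecSupp C ∩ N.star v).card := by
        refine Finset.sum_le_sum fun C hC ↦ ?_
        rw [Finset.mem_filter] at hC
        exact hN.admissible.two_le_card_inter_star hN.len_lt (hK.mem_cycleSpace C hC.1)
          (mem_vertexSupp.1 hC.2)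
    _ = ((K.filter fun C ↦ v ∈ N.vertexSupp C).biUnion fun C ↦ vecSupp C ∩ N.star v).card := by
        refine (Finset.card_biUnion fun C hC D hD hCD ↦ ?_).symm
        exact (hK.disjoint (Finset.mem_of_mem_filter C hC) (Finset.mem_of_mem_filter D hD)
          hCD).mono Finset.inter_subset_left Finset.inter_subset_left
    _ ≤ _ := by
        refine Finset.card_le_card fun e he ↦ ?_
        obtain ⟨C, hC, he⟩ := Finset.mem_biUnion.1 he
        rw [Finset.mem_inter] at he ⊢
        exact ⟨he.2, Finset.mem_biUnion.2 ⟨C, Finset.mem_of_mem_filter C hC, he.1⟩⟩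

/-- The charge that a vertex sends to every short cycle through it. -/
def charge (N : LinkGraph V E) (t : ℕ) (I : Finset E) (v : V) : ℤ :=
  if (N.star v).card = 3 then 11 * (2 * t + 1) - 3 * (∑ e ∈ N.star v \ I, N.len e : ℕ)
  else 11 * (2 * t + 1)

/-- No vertex gives more than it has. With k = 2t+1, degree d, j short cycles and o other edges,
2j+o ≤ d. If d = 3, the vertex gives all it has to its only short cycle, or lies on none and keeps
at least 11k-9k. If d ≥ 4, the claim follows from 11(d-2) ≥ 3o+11j. -/
theorem Reduced.card_mul_charge_le (hN : N.Reduced t) (hK : N.IsShortCycles t K) {v : V}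
    (hv : (N.star v).Nonempty) :
    ((K.filter fun C ↦ v ∈ N.vertexSupp C).card : ℤ) * N.charge t (K.biUnion vecSupp) v ≤
      11 * (2 * t + 1) * ((N.star v).card - 2) -
        3 * (∑ e ∈ N.star v \ K.biUnion vecSupp, N.len e : ℕ) := by
  have h₁ := hN.two_mul_card_add_card_le hK v
  have h₂ := hN.sum_outer_le v (K.biUnion vecSupp)
  have h₃ := hN.three_le_card_star v hv
  unfold charge
  generalize (∑ e ∈ N.star v \ K.biUnion vecSupp, N.len e) = s at *
  generalize (N.star v \ K.biUnion vecSupp).card = o at *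
  generalize (K.filter fun C ↦ v ∈ N.vertexSupp C).card = j at *
  generalize (N.star v).card = d at *
  split_ifs with hd
  · subst hd
    obtain rfl | rfl : j = 0 ∨ j = 1 := by omega
    · have : s ≤ 3 * (2 * t + 1) := h₂.trans (Nat.mul_le_mul_right _ (by omega))
      push_cast
      linarith [(Nat.cast_le (α := ℤ)).2 this, show ((3 * (2 * t + 1) : ℕ) : ℤ) = 3 * (2 * t + 1) by
        push_cast; ring]
    · push_cast
      linarith
  · have hd' : (4 : ℤ) ≤ d := by exact_mod_cast (by omega : 4 ≤ d)
    have h₁' : (2 * j + o : ℤ) ≤ d := by exact_mod_cast h₁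
    have h₂' : (s : ℤ) ≤ o * (2 * t + 1) := by exact_mod_cast h₂
    have ht : (0 : ℤ) < 2 * t + 1 := by positivity
    have hj : (0 : ℤ) ≤ o := by positivity
    nlinarith [mul_nonneg ht.le (show (0 : ℤ) ≤ 11 * (d - 2) - 3 * o - 11 * j by linarith)]

/-- A vertex of degree three on a short cycle has at most one outer edge, of length at most 2t+1,
and 8 = 11-3. -/
theorem Reduced.le_charge (hN : N.Reduced t) (hK : N.IsShortCycles t K) {C : E → ZMod 2}
    (hC : C ∈ K) {v : V} (hv : v ∈ N.vertexSupp C) :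
    (8 * (2 * t + 1) : ℤ) ≤ N.charge t (K.biUnion vecSupp) v := by
  have h₁ := hN.two_mul_card_add_card_le hK v
  have h₂ := hN.sum_outer_le v (K.biUnion vecSupp)
  have h₃ : 0 < (K.filter fun C ↦ v ∈ N.vertexSupp C).card :=
    Finset.card_pos.2 ⟨C, Finset.mem_filter.2 ⟨hC, hv⟩⟩
  unfold charge
  split_ifs with hd
  · have : ∑ e ∈ N.star v \ K.biUnion vecSupp, N.len e ≤ 1 * (2 * t + 1) :=
      h₂.trans (Nat.mul_le_mul_right _ (by omega))
    omega
  · omega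

/-- In units of 2t+1: four vertices give at least 4·8, and three vertices, one of them of degree
above three, give at least 11+8+8. Three vertices of degree three give 33 minus three times the
total length of the exits, which is below 25 only if the triangle is reducible. -/
theorem Reduced.le_sum_charge (hN : N.Reduced t)
    (ih : ∀ M : LinkGraph V E, M.edges.card < N.edges.card → M.Admissible t → M.Colorable t)
    (hcol : ¬ N.Colorable t) (hK : N.IsShortCycles t K) {C : E → ZMod 2} (hC : C ∈ K) :
    (25 * (2 * t + 1) : ℤ) ≤ ∑ v ∈ N.vertexSupp C, N.charge t (K.biUnion vecSupp) v := by
  have hCm := hK.mem_cycleSpace C hC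
  have hCl := hK.length_eq C hC
  have hC₀ : C ≠ 0 := by
    rintro rfl
    simp [length_eq_sum] at hCl
  have h₃ := hN.three_le_card_vertexSupp hCm hC₀
  have h₈ := fun v ↦ hN.le_charge hK hC (v := v)
  rcases Nat.lt_or_ge 3 (N.vertexSupp C).card with h₄ | h₄
  · have := Finset.card_nsmul_le_sum _ _ _ h₈
    rw [nsmul_eq_mul] at this
    have h₄' : (4 : ℤ) ≤ (N.vertexSupp C).card := by exact_mod_cast h₄
    nlinarith
  · obtain ⟨x, y, z, hxy, hxz, hyz, hv⟩ := Finset.card_eq_three.1 (h₄.antisymm h₃)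
    have hx := h₈ x (by simp [hv])
    have hy := h₈ y (by simp [hv])
    have hz := h₈ z (by simp [hv])
    rw [hv, Finset.sum_insert (by simp [hxy, hxz]), Finset.sum_pair hyz]
    have hI : vecSupp C ⊆ K.biUnion vecSupp := Finset.subset_biUnion_of_mem vecSupp hC
    have key := fun h₁ h₂ h₃ ↦ mt (hN.colorable_of_vertexSupp_eq_triple ih hCm hCl hxy hxz hyz hv
      h₁ h₂ h₃ hI) hcol
    unfold charge at *
    by_cases hdx : (N.star x).card = 3
    · by_cases hdy : (N.star y).card = 3
      · by_cases hdz : (N.star z).card = 3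
        · have := key hdx hdy hdz
          rw [if_pos hdx, if_pos hdy, if_pos hdz]
          omega
        · rw [if_neg hdz] at hz ⊢
          omega
      · rw [if_neg hdy] at hy ⊢
        omega
    · rw [if_neg hdx] at hx ⊢
      omega

theorem Reduced.colorable (hN : N.Reduced t)
    (ih : ∀ M : LinkGraph V E, M.edges.card < N.edges.card → M.Admissible t → M.Colorable t)
    (hne : N.edges.Nonempty) : N.Colorable t := by
  by_contra hcol
  obtain ⟨F, hF, hcyc, hcov⟩ := hN.admissible.flat.exists_cycles
  have hdim := card_edges_add_one_le hF hne
  set K := F.filter fun C ↦ N.length C = 2 * t + 1 with hKdef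
  have hK : N.IsShortCycles t K := by
    refine ⟨fun C hC ↦ (hcyc C (Finset.mem_of_mem_filter C hC)).1,
      fun C hC ↦ (Finset.mem_filter.1 hC).2, fun C hC D hD hCD ↦ ?_⟩
    rw [Finset.mem_coe, hKdef, Finset.mem_filter] at hC hD
    exact hN.admissible.disjoint_cycles (hcyc C hC.1).1 (hcyc D hD.1).1 hC.2 hD.2 hCD
  set T := Finset.univ.filter fun v ↦ (N.star v).Nonempty with hT
  set I := K.biUnion vecSupp with hI
  have hIe : I ⊆ N.edges := by
    intro e he
    obtain ⟨C, hC, he⟩ := Finset.mem_biUnion.1 he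
    exact mem_edges_of_mem_vecSupp (hK.mem_cycleSpace C hC) he
  have hstar : ∀ v ∉ T, N.star v = ∅ := by
    intro v hv
    by_contra h
    exact hv (Finset.mem_filter.2 ⟨Finset.mem_univ _, Finset.nonempty_iff_ne_empty.2 h⟩)
  have hcover : ∑ C ∈ F, N.length C ≤ 2 * ∑ e ∈ N.edges, N.len e := by
    calc ∑ C ∈ F, N.length C = ∑ C ∈ F, ∑ e ∈ N.edges, if C e ≠ 0 then N.len e else 0 := by
          refine Finset.sum_congr rfl fun C hC ↦ ?_
          rw [length_eq_sum]
          refine (Finset.sum_subset (Finset.subset_univ _) fun e _ he ↦ ?_).symm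
          rw [if_neg (not_not.2 ((hcyc C hC).1.1 e he))]
      _ = ∑ e ∈ N.edges, ∑ C ∈ F, if C e ≠ 0 then N.len e else 0 := Finset.sum_comm
      _ ≤ ∑ e ∈ N.edges, 2 * N.len e := by
          refine Finset.sum_le_sum fun e _ ↦ ?_
          rw [← Finset.sum_filter, Finset.sum_const, smul_eq_mul]
          exact Nat.mul_le_mul_right _ (hcov e)
      _ = _ := (Finset.mul_sum _ _ _).symm
  -- Short cycles miss the length 22(2t+1)/3; the correction 19 = 22-3 makes up for it.
  have hlower : 22 * (2 * t + 1) * F.card ≤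
      3 * ∑ C ∈ F, N.length C + 19 * (2 * t + 1) * K.card := by
    have h₁ : ∀ C ∈ F, 22 * (2 * t + 1) ≤
        3 * N.length C + 19 * (2 * t + 1) * (if N.length C = 2 * t + 1 then 1 else 0) := by
      intro C hC
      have := hN.admissible.length_cycle C (hcyc C hC)
      split_ifs <;> omega
    have h₂ := Finset.sum_le_sum h₁
    rw [Finset.sum_const, smul_eq_mul, Finset.sum_add_distrib, ← Finset.mul_sum, ← Finset.mul_sum,
      ← Finset.card_filter, mul_comm F.card] at h₂
    exact h₂
  have hinner : ∑ e ∈ I, N.len e = (2 * t + 1) * K.card := by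
    rw [hI, Finset.sum_biUnion hK.disjoint]
    refine (Finset.sum_congr rfl hK.length_eq).trans ?_
    rw [Finset.sum_const, smul_eq_mul, mul_comm]
  have houter : ∑ v ∈ T, ∑ e ∈ N.star v \ I, N.len e = 2 * ∑ e ∈ N.edges \ I, N.len e := by
    rw [← hN.admissible.sum_star hN.len_lt Finset.sdiff_subset]
    refine (Finset.sum_subset (Finset.subset_univ T) fun v _ hv ↦ ?_).trans
      (Finset.sum_congr rfl fun v _ ↦ Finset.sum_congr ?_ fun _ _ ↦ rfl)
    · rw [hstar v hv]; simp
    · ext e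
      simp only [Finset.mem_sdiff, Finset.mem_inter]
      exact ⟨fun h ↦ ⟨h.1, (mem_star.1 h.1).1, h.2⟩, fun h ↦ ⟨h.1, h.2.2⟩⟩
  have hdeg : ∑ v ∈ T, (N.star v).card = 2 * N.edges.card := by
    have := hN.admissible.sum_star hN.len_lt (subset_refl N.edges) fun _ ↦ 1
    simp only [Finset.sum_const, smul_eq_mul, mul_one] at this
    rw [← this]
    refine (Finset.sum_subset (Finset.subset_univ T) fun v _ hv ↦ ?_).trans
      (Finset.sum_congr rfl fun v _ ↦ ?_)
    · rw [hstar v hv]; simp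
    · rw [Finset.inter_eq_left.2 fun e he ↦ (mem_star.1 he).1]
  have hsplit : ∑ e ∈ N.edges \ I, N.len e + ∑ e ∈ I, N.len e = ∑ e ∈ N.edges, N.len e :=
    Finset.sum_sdiff hIe
  -- Double counting of the charge sent from vertices to short cycles.
  have hcharge : (25 * (2 * t + 1) : ℤ) * K.card ≤
      ∑ v ∈ T, ((11 * (2 * t + 1) : ℤ) * ((N.star v).card - 2) -
        3 * (∑ e ∈ N.star v \ I, N.len e : ℕ)) := by
    calc (25 * (2 * t + 1) : ℤ) * K.card = ∑ C ∈ K, (25 * (2 * t + 1) : ℤ) := by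
          rw [Finset.sum_const, nsmul_eq_mul, mul_comm]
      _ ≤ ∑ C ∈ K, ∑ v ∈ N.vertexSupp C, N.charge t I v :=
          Finset.sum_le_sum fun C hC ↦ hN.le_sum_charge ih hcol hK hC
      _ = ∑ C ∈ K, ∑ v ∈ T, if v ∈ N.vertexSupp C then N.charge t I v else 0 := by
          refine Finset.sum_congr rfl fun C hC ↦ ?_
          rw [← Finset.sum_filter]
          refine Finset.sum_congr ?_ fun _ _ ↦ rfl
          ext v
          rw [Finset.mem_filter, iff_and_self]
          intro hv
          obtain ⟨e, he⟩ := mem_vertexSupp.1 hv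
          exact Finset.mem_filter.2 ⟨Finset.mem_univ _, e, (Finset.mem_inter.1 he).2⟩
      _ = ∑ v ∈ T, ((K.filter fun C ↦ v ∈ N.vertexSupp C).card : ℤ) * N.charge t I v := by
          rw [Finset.sum_comm]
          refine Finset.sum_congr rfl fun v _ ↦ ?_
          rw [← Finset.sum_filter, Finset.sum_const, nsmul_eq_mul]
      _ ≤ _ := Finset.sum_le_sum fun v hv ↦ hN.card_mul_charge_le hK (Finset.mem_filter.1 hv).2
  rw [Finset.sum_sub_distrib, ← Finset.mul_sum, ← Finset.mul_sum, Finset.sum_sub_distrib,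
    Finset.sum_const, ← Nat.cast_sum, ← Nat.cast_sum, houter, hdeg, nsmul_eq_mul] at hcharge
  have h₁ : (22 * (2 * t + 1) * F.card : ℤ) ≤
      3 * (2 * ∑ e ∈ N.edges, N.len e : ℕ) + 19 * (2 * t + 1) * K.card := by
    have := hlower.trans (Nat.add_le_add_right (Nat.mul_le_mul_left 3 hcover) _)
    exact_mod_cast this
  have h₂ : ((N.edges.card + 1 : ℤ)) ≤ F.card + T.card := by exact_mod_cast hdim
  have h₃ : ((∑ e ∈ N.edges, N.len e : ℕ) : ℤ) =
      (∑ e ∈ N.edges \ I, N.len e : ℕ) + (2 * t + 1) * K.card := by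
    rw [← hsplit, hinner]; push_cast; ring
  have ht : (0 : ℤ) < 2 * t + 1 := by positivity
  have h₄ := mul_le_mul_of_nonneg_left h₂ (show (0 : ℤ) ≤ 22 * (2 * t + 1) by linarith)
  push_cast at h₁ h₃ hcharge
  -- With k = 2t+1 and outer length o, the length count gives 22k|F| ≤ 6o+25k|K| and the charges
  -- give 25k|K| ≤ 22k(|E|-|T|)-6o. Hence |F|+|T| ≤ |E|, against Euler's inequality.
  nlinarith

end LinkGraph

namespace LinkGraph

variable {V E : Type*} [Fintype E] [DecidableEq V] [DecidableEq E] [Fintype V]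

/-- Admissible link graphs are colourable. -/
theorem Admissible.colorable {N : LinkGraph V E} {t : ℕ} (hN : N.Admissible t) :
    N.Colorable t := by
  induction hn : N.edges.card using Nat.strong_induction_on generalizing N with
  | _ n ih =>
    subst hn
    replace ih : ∀ M : LinkGraph V E, M.edges.card < N.edges.card → M.Admissible t →
        M.Colorable t := fun M hM hM' ↦ ih _ hM hM' rfl
    by_contra hcol
    have hlen : ∀ e ∈ N.edges, N.len e < 2 * t := by
      intro e he
      by_contra! h
      exact hcol (colorable_of_two_mul_le hN ih he h)
    have hred : N.Reduced t := by
      refine ⟨hN, hlen, fun a ha b hb u v hau hbu ↦ ?_, fun v hv ↦ ?_⟩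
      · by_contra hab
        exact hcol (colorable_of_parallel hN ih hlen hab ha hb hau hbu)
      · by_contra! hlt
        have hpos := Finset.card_pos.2 hv
        obtain h | h : (N.star v).card = 1 ∨ (N.star v).card = 2 := by omega
        · obtain ⟨e, he⟩ := Finset.card_eq_one.1 h
          exact hcol (colorable_of_star_eq_singleton hN ih hlen he)
        · obtain ⟨a, b, hab, he⟩ := Finset.card_eq_two.1 h
          exact hcol (colorable_of_star_eq_pair hN ih hlen hab he)
    rcases N.edges.eq_empty_or_nonempty with h | h
    · obtain ⟨X, -, hX⟩ := Finset.exists_subset_card_eq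
        (s := (Finset.univ : Finset (Fin (2 * t + 1)))) (n := t)
        (by rw [Finset.card_univ, Fintype.card_fin]; omega)
      exact hcol ⟨fun _ ↦ X, fun _ ↦ hX, by simp [h]⟩
    · exact hcol (hred.colorable ih h)

end LinkGraph

/-! ### Cycles of a graph and of its link graph. -/

namespace SimpleGraph

variable {V : Type*}

/-- A graph as a link graph all of whose links are edges. -/
noncomputable def toLinkGraph (G : SimpleGraph V) [Fintype G.edgeSet] :
    LinkGraph V G.edgeSet where
  src e := (Quot.out e.1).1
  tgt e := (Quot.out e.1).2
  edges := Finset.univ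
  len _ := 1
  step _ := 1

section

variable {G : SimpleGraph V}

/-- The subgraph that consists of the edges in the support of a vector. -/
def supportGraph (z : G.edgeSet → ZMod 2) : SimpleGraph V :=
  fromEdgeSet {e | ∃ h : e ∈ G.edgeSet, z ⟨e, h⟩ ≠ 0}

theorem supportGraph_adj {z : G.edgeSet → ZMod 2} {u v : V} :
    (supportGraph z).Adj u v ↔ ∃ h : s(u, v) ∈ G.edgeSet, z ⟨s(u, v), h⟩ ≠ 0 := by
  rw [supportGraph, fromEdgeSet_adj]
  exact and_iff_left_of_imp fun ⟨h, _⟩ ↦ G.ne_of_adj h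

theorem supportGraph_le (z : G.edgeSet → ZMod 2) : supportGraph z ≤ G := fun _ _ h ↦
  (supportGraph_adj.1 h).1

variable [Fintype G.edgeSet]

theorem mk_src_tgt_toLinkGraph (e : G.edgeSet) :
    s(G.toLinkGraph.src e, G.toLinkGraph.tgt e) = e.1 := Quot.out_eq e.1

theorem adj_src_tgt_toLinkGraph (e : G.edgeSet) :
    G.Adj (G.toLinkGraph.src e) (G.toLinkGraph.tgt e) := by
  rw [← mem_edgeSet, mk_src_tgt_toLinkGraph]
  exact e.2

variable [DecidableEq V]

theorem inc_toLinkGraph (e : G.edgeSet) {u v : V} (h : e.1 = s(u, v)) (w : V) :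
    G.toLinkGraph.inc e w = (if u = w then 1 else 0) + (if v = w then 1 else 0) := by
  rw [← mk_src_tgt_toLinkGraph, Sym2.eq_iff] at h
  exact LinkGraph.Joins.inc_eq h w

theorem inc_toLinkGraph_eq_ite (e : G.edgeSet) (w : V) :
    G.toLinkGraph.inc e w = if w ∈ e.1 then 1 else 0 := by
  have h := mk_src_tgt_toLinkGraph e
  have hne := (adj_src_tgt_toLinkGraph e).ne
  rw [← h, LinkGraph.inc]
  generalize G.toLinkGraph.src e = a at *
  generalize G.toLinkGraph.tgt e = b at *
  by_cases h₁ : a = w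
  · subst h₁
    simp [hne.symm]
  · by_cases h₂ : b = w
    · subst h₂
      simp [hne]
    · simp [h₁, h₂, Ne.symm h₁, Ne.symm h₂]

/-- If an edge e of the support were a bridge, summing the vertex equations over one side of it
would cancel every other edge and leave z e = 0. -/
theorem not_isAcyclic_supportGraph [Fintype V] {z : G.edgeSet → ZMod 2}
    (hz : z ∈ G.toLinkGraph.cycleSpace) (hz₀ : z ≠ 0) : ¬ (supportGraph z).IsAcyclic := by
  classical
  intro hac
  obtain ⟨e, he⟩ : ∃ e, z e ≠ 0 := by
    by_contra! h
    exact hz₀ (funext h)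
  have hsrc := mk_src_tgt_toLinkGraph e
  set u := G.toLinkGraph.src e
  set v := G.toLinkGraph.tgt e
  have huv : (supportGraph z).Adj u v := by
    rw [supportGraph_adj]
    simp only [hsrc]
    exact ⟨e.2, he⟩
  have hb := isAcyclic_iff_forall_adj_isBridge.1 hac huv
  rw [isBridge_iff] at hb
  set H := (supportGraph z).deleteEdges {s(u, v)} with hH
  let A : Finset V := Finset.univ.filter fun w ↦ H.Reachable u w
  have hsum : ∑ w ∈ A, ∑ f, z f * G.toLinkGraph.inc f w = 0 :=
    Finset.sum_eq_zero fun w _ ↦ hz.2 w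
  rw [Finset.sum_comm, Finset.sum_eq_single e] at hsum
  · rw [← Finset.mul_sum] at hsum
    have : ∑ w ∈ A, G.toLinkGraph.inc e w = 1 := by
      simp only [inc_toLinkGraph e hsrc.symm, Finset.sum_add_distrib, Finset.sum_ite_eq]
      rw [if_pos (by simp [A]), if_neg (by simpa [A] using hb), add_zero]
    rw [this, mul_one] at hsum
    exact he hsum
  · intro f _ hfe
    by_cases hzf : z f = 0
    · simp [hzf]
    rw [← Finset.mul_sum]
    have hf := mk_src_tgt_toLinkGraph f
    simp only [LinkGraph.inc, Finset.sum_add_distrib, Finset.sum_ite_eq]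
    have hadj : H.Adj (G.toLinkGraph.src f) (G.toLinkGraph.tgt f) := by
      rw [hH, deleteEdges_adj, supportGraph_adj, hf]
      refine ⟨⟨f.2, hzf⟩, ?_⟩
      rw [Set.mem_singleton_iff, hsrc]
      exact fun h ↦ hfe (Subtype.ext h)
    have hiff : G.toLinkGraph.src f ∈ A ↔ G.toLinkGraph.tgt f ∈ A := by
      simp only [A, Finset.mem_filter, Finset.mem_univ, true_and]
      exact ⟨fun h ↦ h.trans hadj.reachable, fun h ↦ h.trans hadj.symm.reachable⟩
    simp only [hiff]
    rw [CharTwo.add_self_eq_zero, mul_zero]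
  · simp

/-- A cycle of the link graph of a graph comes from a cycle of the graph. -/
theorem exists_isCycle_of_isCycle_toLinkGraph [Fintype V] {z : G.edgeSet → ZMod 2}
    (hz : G.toLinkGraph.IsCycle z) :
    ∃ (v : V) (w : G.Walk v v), w.IsCycle ∧ G.toLinkGraph.length z = w.length := by
  classical
  obtain ⟨hzm, hz₀, hmin⟩ := hz
  obtain ⟨v, c, hc⟩ : ∃ v, ∃ c : (supportGraph z).Walk v v, c.IsCycle := by
    by_contra! h
    exact not_isAcyclic_supportGraph hzm hz₀ h
  set w := c.mapLe (supportGraph_le z)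
  have hw : w.IsCycle := hc.mapLe _
  have hwc : w.edges = c.edges := Walk.edges_mapLe_eq_edges _ _
  have hnd : w.edges.Nodup := hw.isTrail.edges_nodup
  -- The indicator of a graph cycle inside the support lies in the cycle space; minimality of z
  -- makes the two equal.
  let y : G.edgeSet → ZMod 2 := fun e ↦ if e.1 ∈ w.edges then 1 else 0
  have hysupp : (vecSupp y).map (Function.Embedding.subtype _) = w.edges.toFinset := by
    ext e
    simp only [Finset.mem_map, mem_vecSupp, Function.Embedding.subtype_apply, List.mem_toFinset, y]
    constructor
    · rintro ⟨f, hf, rfl⟩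
      by_contra h
      exact hf (if_neg h)
    · intro he
      exact ⟨⟨e, w.edges_subset_edgeSet he⟩, by simp [he], rfl⟩
  have hcard : (vecSupp y).card = w.length := by
    rw [← Finset.card_map, hysupp, List.toFinset_card_of_nodup hnd, Walk.length_edges]
  have hy₀ : y ≠ 0 := by
    rw [Ne, ← vecSupp_eq_empty, ← Finset.card_eq_zero, hcard]
    have := hw.three_le_length
    omega
  have hym : y ∈ G.toLinkGraph.cycleSpace := by
    refine ⟨fun e he ↦ absurd (Finset.mem_univ e) he, fun x ↦ ?_⟩
    have h₁ : ∀ e : G.edgeSet, y e * G.toLinkGraph.inc e x =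
        if e.1 ∈ w.edges ∧ x ∈ e.1 then 1 else 0 := by
      intro e
      rw [inc_toLinkGraph_eq_ite]
      by_cases h : e.1 ∈ w.edges <;> by_cases h' : x ∈ e.1 <;> simp [y, h, h']
    simp only [h₁]
    rw [Finset.sum_boole]
    have h₂ : (Finset.univ.filter fun e : G.edgeSet ↦ e.1 ∈ w.edges ∧ x ∈ e.1).card =
        w.edges.countP fun e ↦ x ∈ e := by
      rw [List.countP_eq_length_filter, ← List.toFinset_card_of_nodup (hnd.filter _),
        ← Finset.card_map (Function.Embedding.subtype _)]
      congr 1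
      ext e
      simp only [Finset.mem_map, Finset.mem_filter, Finset.mem_univ, true_and,
        Function.Embedding.subtype_apply, List.mem_toFinset, List.mem_filter, decide_eq_true_eq]
      constructor
      · rintro ⟨f, hf, rfl⟩
        exact hf
      · intro he
        exact ⟨⟨e, w.edges_subset_edgeSet he.1⟩, he, rfl⟩
    rw [h₂, ZMod.natCast_eq_zero_iff_even, hw.isTrail.even_countP_edges_iff]
    exact fun h ↦ absurd rfl h
  have hyz : y = z := by
    refine hmin y hym hy₀ fun e he ↦ ?_
    have he' : e.1 ∈ w.edges := by
      by_contra h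
      exact mem_vecSupp.1 he (if_neg h)
    rw [hwc] at he'
    obtain ⟨h, h'⟩ := ((edgeSet_fromEdgeSet (V := V) _).le
      (c.edges_subset_edgeSet he')).1
    exact mem_vecSupp.2 h'
  refine ⟨v, w, hw, ?_⟩
  rw [← hyz, LinkGraph.length, ← hcard, Finset.card_eq_sum_ones]
  rfl

end

end SimpleGraph

/-! ### From genus zero to MacLane's criterion. -/

namespace SimpleGraph

namespace RotationSystem

variable {V : Type*} {G : SimpleGraph V} (R : G.RotationSystem)

theorem facePerm_apply (d : G.Dart) : R.facePerm d = R.next d.symm := rfl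

theorem facePerm_fst (d : G.Dart) : (R.facePerm d).fst = d.snd := R.next_fst d.symm

/-- The face orbit of a dart. -/
def orbit (d : G.Dart) : R.FaceOrbit := Quotient.mk (Equiv.Perm.SameCycle.setoid R.facePerm) d

theorem orbit_surjective : Function.Surjective R.orbit := Quotient.mk_surjective

theorem orbit_facePerm (d : G.Dart) : R.orbit (R.facePerm d) = R.orbit d :=
  Quotient.sound (s := Equiv.Perm.SameCycle.setoid R.facePerm)
    (Equiv.Perm.sameCycle_apply_left.2 (Equiv.Perm.SameCycle.refl _ _))

instance [Finite V] : Finite R.FaceOrbit :=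
  have : Finite G.Dart := Finite.of_injective _ Dart.toProd_injective
  Finite.of_surjective _ R.orbit_surjective

/-- A function on the face orbits that takes the same value on both sides of every edge is
constant on every connected component. -/
theorem eq_of_reachable {α : Type*} {g : R.FaceOrbit → α}
    (hg : ∀ d : G.Dart, g (R.orbit d) = g (R.orbit d.symm)) {d e : G.Dart}
    (h : G.Reachable d.fst e.fst) : g (R.orbit d) = g (R.orbit e) := by
  -- The successor of d lies on the face of the reversed dart, so g is constant around each vertex.
  have hnext : ∀ d, g (R.orbit (R.next d)) = g (R.orbit d) := by
    intro d
    have h₁ := R.orbit_facePerm d.symm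
    rw [facePerm_apply, Dart.symm_symm] at h₁
    rw [h₁, ← hg]
  have hcycle : ∀ d e, R.next.SameCycle d e → g (R.orbit d) = g (R.orbit e) := by
    rintro d e ⟨n, rfl⟩
    induction n using Int.induction_on with
    | zero => rfl
    | succ n ih => rw [ih, add_comm, zpow_add, zpow_one, Equiv.Perm.mul_apply, hnext]
    | pred n ih =>
      rw [ih, ← hnext ((R.next ^ (-(n : ℤ) - 1)) d), ← Equiv.Perm.mul_apply, ← zpow_one_add]
      ring_nf
  obtain ⟨p⟩ := h
  generalize hu : d.fst = u at p
  generalize hv : e.fst = v at p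
  induction p generalizing d with
  | nil => exact hcycle _ _ (R.sameCycle _ _ (hu.trans hv.symm))
  | cons hadj _ ih =>
    rw [← ih (d := ⟨(_, _), hadj.symm⟩) rfl hv]
    rw [hg ⟨(_, _), hadj.symm⟩]
    exact hcycle _ _ (R.sameCycle _ _ hu)

section

variable [Fintype V] [DecidableEq V] [DecidableRel G.Adj]

/-- The boundary of a combination of faces, as a linear map. -/
noncomputable def boundary : (R.FaceOrbit → ZMod 2) →ₗ[ZMod 2] (G.edgeSet → ZMod 2) where
  toFun g e := ∑ d : G.Dart with d.edge = e.1, g (R.orbit d)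
  map_add' g h := by
    funext e; simp [Finset.sum_add_distrib]
  map_smul' c g := by
    funext e; simp [Finset.mul_sum]

theorem boundary_apply (g : R.FaceOrbit → ZMod 2) (e : G.edgeSet) :
    R.boundary g e = ∑ d : G.Dart with d.edge = e.1, g (R.orbit d) := rfl

theorem boundary_edge (g : R.FaceOrbit → ZMod 2) (d : G.Dart) :
    R.boundary g ⟨d.edge, d.edge_mem⟩ = g (R.orbit d) + g (R.orbit d.symm) := by
  rw [boundary_apply, Dart.edge_fiber, Finset.sum_pair d.symm_ne.symm]

/-- Face tracing matches each dart entering v with one leaving v on the same face, so the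
contributions at v cancel in pairs. -/
theorem boundary_mem_cycleSpace (g : R.FaceOrbit → ZMod 2) :
    R.boundary g ∈ G.toLinkGraph.cycleSpace := by
  refine ⟨fun e he ↦ absurd (Finset.mem_univ e) he, fun v ↦ ?_⟩
  have h₁ : ∑ e, R.boundary g e * G.toLinkGraph.inc e v =
      ∑ d : G.Dart, g (R.orbit d) *
        ((if d.fst = v then 1 else 0) + (if d.snd = v then 1 else 0)) := by
    rw [← Finset.sum_fiberwise_of_maps_to (s := (Finset.univ : Finset G.Dart))
      (t := (Finset.univ : Finset G.edgeSet)) (g := fun d ↦ ⟨d.edge, d.edge_mem⟩)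
      fun _ _ ↦ Finset.mem_univ _]
    refine Finset.sum_congr rfl fun e _ ↦ ?_
    rw [boundary_apply, Finset.sum_mul]
    refine Finset.sum_congr (by ext; simp [Subtype.ext_iff]) fun d hd ↦ ?_
    rw [inc_toLinkGraph e (u := d.fst) (v := d.snd)]
    simp only [Finset.mem_filter, Finset.mem_univ, true_and] at hd
    rw [← hd]
    rfl
  have h₂ : ∑ d : G.Dart, g (R.orbit d) * (if d.snd = v then 1 else 0) =
      ∑ d : G.Dart, g (R.orbit d) * (if d.fst = v then 1 else 0) := by
    refine Fintype.sum_equiv R.facePerm _ _ fun d ↦ ?_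
    rw [orbit_facePerm, facePerm_fst]
  rw [h₁]
  simp only [mul_add, Finset.sum_add_distrib]
  rw [h₂, CharTwo.add_self_eq_zero]

/-- A kernel element takes equal values on both sides of every edge, so it is determined by one
value for each component that has an edge; isolated vertices are the other components. -/
theorem finrank_ker_boundary_add_le : Module.finrank (ZMod 2) (LinearMap.ker R.boundary) +
    Nat.card {v : V // ∀ w, ¬ G.Adj v w} ≤ Nat.card G.ConnectedComponent := by
  classical
  let comp : G.Dart → G.ConnectedComponent := fun d ↦ G.connectedComponentMk d.fst
  have hrep : ∀ c : Set.range comp, ∃ d, comp d = c := fun c ↦ c.2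
  choose rep hrep using hrep
  let φ : LinearMap.ker R.boundary →ₗ[ZMod 2] (Set.range comp → ZMod 2) :=
    { toFun := fun g c ↦ g.1 (R.orbit (rep c))
      map_add' := fun _ _ ↦ rfl
      map_smul' := fun _ _ ↦ rfl }
  have hφ : Function.Injective φ := by
    rw [injective_iff_map_eq_zero]
    rintro ⟨g, hg⟩ h
    ext f
    obtain ⟨d, rfl⟩ := R.orbit_surjective f
    have hsymm : ∀ d : G.Dart, g (R.orbit d) = g (R.orbit d.symm) := by
      intro d
      have := congrFun (LinearMap.mem_ker.1 hg) ⟨d.edge, d.edge_mem⟩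
      rw [boundary_edge] at this
      exact CharTwo.add_eq_zero.1 this
    have h₁ := hrep ⟨comp d, d, rfl⟩
    have h₂ := R.eq_of_reachable hsymm (ConnectedComponent.exact h₁)
    exact h₂.symm.trans (congrFun h _)
  have h₁ := LinearMap.finrank_le_finrank_of_injective hφ
  rw [Module.finrank_fintype_fun_eq_card, ← Nat.card_eq_fintype_card] at h₁
  let ψ : Set.range comp ⊕ {v : V // ∀ w, ¬ G.Adj v w} → G.ConnectedComponent :=
    Sum.elim Subtype.val fun v ↦ G.connectedComponentMk v.1
  have hiso : ∀ v w : V, (∀ w, ¬ G.Adj v w) → G.connectedComponentMk v = G.connectedComponentMk w →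
      v = w := by
    intro v w hv h
    obtain ⟨p⟩ := ConnectedComponent.exact h
    cases p with
    | nil => rfl
    | cons hadj _ => exact absurd hadj (hv _)
  have hψ : Function.Injective ψ := by
    rintro (⟨_, d, rfl⟩ | v) (⟨_, e, rfl⟩ | w) h
    · exact congrArg Sum.inl (Subtype.ext h)
    · exact absurd (hiso w.1 d.fst w.2 h.symm ▸ d.adj) (w.2 _)
    · exact absurd (hiso v.1 e.fst v.2 h ▸ e.adj) (v.2 _)
    · exact congrArg Sum.inr (Subtype.ext (hiso v.1 w.1 v.2 h))
  have h₂ := Nat.card_le_card_of_injective ψ hψ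
  rw [Nat.card_sum] at h₂
  omega

end

end RotationSystem

section

variable {V : Type*} {G : SimpleGraph V} [Fintype V] [DecidableEq V] [DecidableRel G.Adj]

/-- The cycle space is the kernel of the incidence matrix. The kernel of the transpose consists of
functions constant on components, which bounds the rank from below. -/
theorem finrank_cycleSpace_add_le :
    Module.finrank (ZMod 2) G.toLinkGraph.cycleSpace + Nat.card V ≤
      Nat.card G.edgeSet + Nat.card G.ConnectedComponent := by
  classical
  let M : Matrix V G.edgeSet (ZMod 2) := fun v e ↦ G.toLinkGraph.inc e v
  have hker : LinearMap.ker M.mulVecLin = G.toLinkGraph.cycleSpace := by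
    ext z
    rw [LinearMap.mem_ker, LinkGraph.mem_cycleSpace, Matrix.mulVecLin_apply]
    constructor
    · intro h
      refine ⟨fun e he ↦ absurd (Finset.mem_univ e) he, fun v ↦ ?_⟩
      rw [← show (M.mulVec z) v = 0 from congrFun h v]
      exact Finset.sum_congr rfl fun e _ ↦ mul_comm _ _
    · rintro ⟨-, h⟩
      funext v
      exact (Finset.sum_congr rfl fun e _ ↦ mul_comm _ _).trans (h v)
  have h₁ := LinearMap.finrank_range_add_finrank_ker M.mulVecLin
  have h₂ := LinearMap.finrank_range_add_finrank_ker M.transpose.mulVecLin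
  rw [hker] at h₁
  have h₃ : M.transpose.rank = M.rank := M.rank_transpose
  rw [Matrix.rank, Matrix.rank] at h₃
  rw [Module.finrank_fintype_fun_eq_card, ← Nat.card_eq_fintype_card] at h₁ h₂
  let φ : LinearMap.ker M.transpose.mulVecLin →ₗ[ZMod 2] (G.ConnectedComponent → ZMod 2) :=
    { toFun := fun f c ↦ f.1 c.out
      map_add' := fun _ _ ↦ rfl
      map_smul' := fun _ _ ↦ rfl }
  have hφ : Function.Injective φ := by
    rw [injective_iff_map_eq_zero]
    rintro ⟨f, hf⟩ h
    have hadj : ∀ u v, G.Adj u v → f u = f v := by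
      intro u v huv
      have := congrFun (LinearMap.mem_ker.1 hf) ⟨s(u, v), huv⟩
      rw [Matrix.mulVecLin_apply] at this
      change ∑ w, G.toLinkGraph.inc ⟨s(u, v), huv⟩ w * f w = 0 at this
      simp only [inc_toLinkGraph ⟨s(u, v), huv⟩ rfl, add_mul, ite_mul, one_mul, zero_mul,
        Finset.sum_add_distrib, Finset.sum_ite_eq, Finset.mem_univ, if_true] at this
      exact CharTwo.add_eq_zero.1 this
    have hreach : ∀ u v, G.Reachable u v → f u = f v := by
      rintro u v ⟨p⟩
      induction p with
      | nil => rfl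
      | cons h _ ih => rw [hadj _ _ h, ih]
    ext v
    refine (hreach v _ (ConnectedComponent.exact ?_)).trans
      (congrFun h (G.connectedComponentMk v))
    exact (Quot.out_eq (G.connectedComponentMk v)).symm
  have h₄ := LinearMap.finrank_le_finrank_of_injective hφ
  rw [Module.finrank_fintype_fun_eq_card, ← Nat.card_eq_fintype_card] at h₄
  omega

/-- The boundaries of the faces of an embedding of genus zero span the cycle space, and every edge
is on the boundary of at most two of them. -/
theorem RotationSystem.IsSpherical.isFlat {R : G.RotationSystem} (h : R.IsSpherical) :
    G.toLinkGraph.IsFlat := by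
  classical
  have := Fintype.ofFinite R.FaceOrbit
  have hrange : LinearMap.range R.boundary = G.toLinkGraph.cycleSpace := by
    refine Submodule.eq_of_le_of_finrank_le ?_ ?_
    · rintro _ ⟨g, rfl⟩
      exact R.boundary_mem_cycleSpace g
    · have h₁ := LinearMap.finrank_range_add_finrank_ker R.boundary
      rw [Module.finrank_fintype_fun_eq_card, ← Nat.card_eq_fintype_card] at h₁
      -- The rank of the boundary map is at least |F|-c, where F includes the faces of isolated
      -- vertices and c counts components. Genus zero turns this into |E|-|V|+c, an upper bound for
      -- the dimension of the cycle space.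
      have h₂ := R.finrank_ker_boundary_add_le
      have h₃ := finrank_cycleSpace_add_le (G := G)
      unfold RotationSystem.IsSpherical RotationSystem.Face at h
      rw [Nat.card_sum] at h
      omega
  refine ⟨Finset.univ.image fun f ↦ R.boundary (Pi.single f 1), ?_, fun e ↦ ?_⟩
  · rw [← hrange, Finset.coe_image, Finset.coe_univ, Set.image_univ, LinearMap.range_eq_map,
      ← (Pi.basisFun (ZMod 2) R.FaceOrbit).span_eq, Submodule.map_span, ← Set.range_comp]
    congr 2
  · rw [Finset.filter_image]
    refine Finset.card_image_le.trans ?_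
    refine le_trans (Finset.card_le_card (t := (Finset.univ.filter fun d : G.Dart ↦
      d.edge = e.1).image R.orbit) fun f hf ↦ ?_) (Finset.card_image_le.trans
      (G.dart_edge_fiber_card e.1 e.2).le)
    rw [Finset.mem_filter, R.boundary_apply] at hf
    obtain ⟨d, hd, hdf⟩ := Finset.exists_ne_zero_of_sum_ne_zero hf.2
    refine Finset.mem_image.2 ⟨d, hd, ?_⟩
    by_contra hne
    exact hdf (Pi.single_eq_of_ne hne _)

end

end SimpleGraph

/-! ### The theorem for planar graphs. -/

theorem theorem1p6 (k : ℕ) (hk : 5 ≤ k) (hodd : Odd k)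
    {V : Type*} [Finite V] (G : SimpleGraph V) (hplanar : G.IsPlanar)
    (hgirth : (k : ℕ∞) ≤ G.egirth)
    (hcycles : ∀ (v : V) (w : G.Walk v v), w.IsCycle →
      ¬ (k + 1 ≤ w.length ∧ w.length ≤ 22 * k / 3)) :
    Nonempty (G.FractionalColoring k ((k - 1) / 2)) := by
  classical
  have := Fintype.ofFinite V
  obtain ⟨t, rfl⟩ := hodd
  obtain ⟨R, hR⟩ := hplanar
  have hadm : G.toLinkGraph.Admissible t := by
    refine ⟨fun _ _ ↦ le_rfl, fun _ _ ↦ by change 1 ≤ t; omega, fun _ _ ↦ le_rfl, hR.isFlat,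
      fun z hz ↦ ?_⟩
    obtain ⟨v, w, hw, hl⟩ := SimpleGraph.exists_isCycle_of_isCycle_toLinkGraph hz
    have h₁ : 2 * t + 1 ≤ w.length := by
      exact_mod_cast hgirth.trans (SimpleGraph.egirth_le_length hw)
    have h₂ := hcycles v w hw
    omega
  obtain ⟨φ, hφ, h⟩ := hadm.colorable
  refine ⟨⟨φ, fun v ↦ by rw [hφ]; omega, fun u v huv ↦ ?_⟩⟩
  have h₁ := h ⟨s(u, v), huv⟩ (Finset.mem_univ _)
  have hj : G.toLinkGraph.Joins ⟨s(u, v), huv⟩ u v := by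
    have := SimpleGraph.mk_src_tgt_toLinkGraph (G := G) ⟨s(u, v), huv⟩
    rwa [Sym2.eq_iff] at this
  rw [hj.inter_card] at h₁
  -- For length and step 1 the relation says that the odd distance 2m+1 is 1.
  have h₂ : (φ u ∩ φ v).card = 0 := by
    change LinkRel t 1 1 _ at h₁
    unfold LinkRel at h₁
    omega
  rw [Finset.disjoint_iff_inter_eq_empty, ← Finset.card_eq_zero, h₂]
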